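/- Theorem. Let $\nu=\mathrm{Bin}(2,1/2)$, and let $\tilde\nu$ be the size-biased law of $\nu$ shifted down by one, i.e. $\tilde\nu(i)=(i+1)\,\nu(i+1)$ for $i\ge 0$. Let $T_\infty$ be the BGW$(2,1/2)$ tree conditioned on non-extinction, that is, Kesten's infinite random tree constructed as follows: take an infinite path (the spine) $S_0,S_1,S_2,\dots$ rooted at $S_0$ and directed towards $S_0$; give each $S_h$, independently, a $\tilde\nu$-distributed number of additional children; and let each of these additional children be the root of an independent Galton–Watson tree with offspring law $\nu$, all edges being directed towards the root $S_0$. Let $\alpha\ge 0$. Given $T_\infty$, let independent $\mathrm{Po}(\alpha)$ numbers of cars arrive at the vertices of $T_\infty$ ($\mathrm{Po}(0)$ being the point mass at $0$). Each vertex is a parking space for one car. The cars arrive one by one. A car parks at its arrival vertex if that vertex is empty; otherwise it drives along the unique directed path towards the root and parks at the first empty vertex it meets; if it meets none, it leaves the tree. Let $A_\alpha$ be the event that all of the arriving cars can park on $T_\infty$, i.e. that no car ever leaves the tree, in whatever order the cars arrive. Then \[ \mathbb P(A_\alpha)=\begin{cases} e^{\alpha/2}\sqrt{\dfrac{\alpha^2-4\alpha+2}{2(1-\alpha)}},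 & 0\le \alpha\le 2-\sqrt2,\\[2mm] 0, & \alpha>2-\sqrt2.\end{cases} \] -/

import Mathlib

open MeasureTheory ProbabilityTheory
open scoped NNReal ENNReal

namespace KestenParking

/-! ### Offspring laws -/

/-- The offspring law `Bin(2, 1/2)`, as a measure on `ℕ`. -/
noncomputable def offspringLaw : Measure ℕ :=
  ProbabilityTheory.binomial 2 ⟨1 / 2, by norm_num, by norm_num⟩

/-- The size-biased law of `ν` shifted down by one: it gives mass `(i + 1) * ν {i + 1}` to `i`. -/
noncomputable def sizeBiasedShift (ν : Measure ℕ) : Measure ℕ :=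
  Measure.sum fun i : ℕ => (((i : ℝ≥0∞) + 1) * ν {i + 1}) • Measure.dirac i

/-! ### Binary family trees -/

/-- Vertices of the infinite binary tree: finite words on two letters, written with the last
letter first, so that `j :: u` is the child of `u` with label `j` and the root is `[]`. -/
abbrev Word := List (Fin 2)

/-- The family tree of a branching process in which the individual `u` has `c u` children:
it contains the root, and the child `j :: u` of each of its members `u` with `j < c u`.
If the numbers `c u` are independent with law `Bin(2, 1/2)`, this is a `BGW(2, 1/2)` tree. -/
inductive familyTree (c : Word → ℕ) : Set Word
  | root : familyTree c []
  | child {u : Word} {j : Fin 2} (hu : familyTree c u) (hj : (j : ℕ) < c u) :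
      familyTree c (j :: u)

/-! ### Kesten's infinite tree -/

/-- The possible vertices of Kesten's tree: `spine h` is the vertex of the spine at height `h`,
and `graft h i u` is the vertex `u` of the `i`-th tree attached to `spine h`. -/
inductive Vertex
  | spine (h : ℕ) : Vertex
  | graft (h i : ℕ) (u : Word) : Vertex
  deriving DecidableEq

/-- The vertex set of Kesten's tree: the whole spine, together with `k h` family trees attached
to `spine h` for each `h`, where the individual `u` of the `i`-th of them has `c h i u`
children. -/
inductive kestenTree (k : ℕ → ℕ) (c : ℕ → ℕ → Word → ℕ) : Set Vertex
  | spine (h : ℕ) : kestenTree k c (Vertex.spine h)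
  | graft (h i : ℕ) (u : Word) (hi : i < k h) (hu : u ∈ familyTree (c h i)) :
      kestenTree k c (Vertex.graft h i u)

/-- The path from `spine h` to the root `spine 0`. -/
def spinePath : ℕ → List Vertex
  | 0 => [Vertex.spine 0]
  | h + 1 => Vertex.spine (h + 1) :: spinePath h

/-- The path from `graft h i u` to the root: it goes down to the root `graft h i []` of the
attached tree, whose parent is `spine h`, and then along the spine. -/
def graftPath (h i : ℕ) : Word → List Vertex
  | [] => Vertex.graft h i [] :: spinePath h
  | j :: u => Vertex.graft h i (j :: u) :: graftPath h i u

/-- The directed path from a vertex (included) to the root `spine 0` of Kesten's tree. -/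
def pathToRoot : Vertex → List Vertex
  | Vertex.spine h => spinePath h
  | Vertex.graft h i u => graftPath h i u

/-! ### Parking -/

/-- The vertex where a car arriving at `v` parks when the vertices in `occ` are occupied: the
first vertex outside `occ` on the path from `v` to the root, or `none` if the car leaves the
tree. -/
def parkingSpot (occ : Finset Vertex) (v : Vertex) : Option Vertex :=
  (pathToRoot v).find? fun w => decide (w ∉ occ)

/-- Cars arrive one by one, the successive arrival vertices being listed in the second argument,
and the vertices in `occ` are occupied at the start: no car leaves the tree. -/
def AllPark : Finset Vertex → List Vertex → Prop
  | _, [] => True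
  | occ, v :: l => ∃ s, parkingSpot occ v = some s ∧ AllPark (insert s occ) l

/-- All cars can park on the tree `t` when `a v` cars arrive at each vertex `v` of `t`:
whatever the order in which the cars arrive one by one on the initially empty tree, no car ever
leaves the tree. Since a car leaving would do so after finitely many arrivals, this is expressed
through the finite sequences of arrivals, in which at most `a v` cars arrive at each `v`. -/
def AllCarsPark (t : Set Vertex) (a : Vertex → ℕ) : Prop :=
  ∀ l : List Vertex, (∀ v ∈ l, v ∈ t) → (∀ v, l.count v ≤ a v) → AllPark ∅ l

end KestenParking

/-!
The probability that all cars park is a limit of probabilities on truncated trees, which a recursion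
for generating functions determines.

*Parking.* Call the flow at a vertex the number of cars that visit it: the number of cars that
arrive there plus the sum of `flow - 1` (truncated at `0`) over the children. All cars park if and
only if no finite subtree containing the root receives more cars than it has vertices: for a
violating subtree the pigeonhole principle applies, and conversely a car that leaves has found the
component of the root full of cars that arrived in it. By optimizing over subtrees this means that
the flow at the root, computed with the first `n` generations, is at most `1` for all `n`
(`allCarsPark_iff_flow_le_one`).

*Generating functions.* Let `G n`, `H n` and `W n` be the generating functions of `X`, `X - 1` and
`Y - 1`, where `X` and `Y` are the flows at the root of the Galton-Watson tree and of Kesten's tree,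
truncated at `n` generations, and the differences are truncated at `0`. With
`F n x = e^{-α(1-x)} (1 + H n x) / 2`, independence along the tree gives (`IsModel.flowRecursion`)
`x H n x = G n x - (1 - x) G n 0`, `G (n+1) x = e^{α(1-x)} (F n x)²` and
`x W (n+1) x = F n x * W n x - (1 - x) F n 0 * W n 0`,
and the probability wanted is `p = lim W n 0`.

*The limit.* All these functions decrease in `n`. The limit `Γ` of `G n` satisfies
`(√Γ(x) - x e^{α(1-x)/2})² = x² e^{α(1-x)} - x + (1 - x) Γ(0)`, and `F = lim F n` satisfies
`F(x) - x = e^{-α(1-x)/2} s(x)`, where `s(x) = √Γ(x) - x e^{α(1-x)/2}`. The recursion for `W` yields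
`F(0) p (1 - x) ≤ (F(x) - x) lim W n x`, so `p = 0` as soon as `s(x) ≤ 0` for some `x` in `(0, 1)`.
If `s > 0` on `(0, 1)`, then `0 < s(x) ≤ 1 - x`, so the linear term of the expansion of `s²` at `1`
vanishes, that is, `Γ(0) = 1 - α`, and `s(x) / (1 - x)` tends to `√c` with
`c = (α² - 4α + 2) / 2 ≥ 0`, which forces `α ≤ 2 - √2`. As `W n` is decreasing in `n` and
`W n x → 1` for `x → 1`, the recursion also gives `F n 0 * W n 0 ≥ √c`; so `F(0) p = √c`, where
`F(0) = e^{-α/2} √(1 - α)`. Finally, for `α ≤ 2 - √2` the function `s²` is strictly convex on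
`[0, 1]` and vanishes at `1`, hence nowhere else, and `s` keeps the sign of `s(0) = √Γ(0) > 0`.
-/

namespace KestenParking

/-! ### Descendants in Kesten's tree -/

lemma exists_pathToRoot_eq_cons (v : Vertex) : ∃ l, pathToRoot v = v :: l := by
  rcases v with h | ⟨h, i, u⟩
  · cases h <;> exact ⟨_, rfl⟩
  · cases u <;> exact ⟨_, rfl⟩

lemma mem_pathToRoot_self (v : Vertex) : v ∈ pathToRoot v := by
  obtain ⟨l, h⟩ := exists_pathToRoot_eq_cons v
  simp [h]

lemma pathToRoot_injective : Function.Injective pathToRoot := by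
  intro v w h
  obtain ⟨l, hl⟩ := exists_pathToRoot_eq_cons v
  obtain ⟨m, hm⟩ := exists_pathToRoot_eq_cons w
  rw [hl, hm] at h
  exact (List.cons.inj h).1

/-- Every vertex but `spine 0` has a parent. -/
lemma eq_spine_zero_or_exists_parent (v : Vertex) :
    v = Vertex.spine 0 ∨ ∃ p, pathToRoot v = v :: pathToRoot p := by
  rcases v with (_ | h) | ⟨h, i, _ | ⟨j, u⟩⟩
  · exact Or.inl rfl
  · exact Or.inr ⟨Vertex.spine h, rfl⟩
  · exact Or.inr ⟨Vertex.spine h, rfl⟩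
  · exact Or.inr ⟨Vertex.graft h i u, rfl⟩

lemma pathToRoot_suffix_of_mem {v w : Vertex} (h : v ∈ pathToRoot w) :
    pathToRoot v <:+ pathToRoot w := by
  induction hn : (pathToRoot w).length generalizing w with
  | zero =>
    obtain ⟨l, hl⟩ := exists_pathToRoot_eq_cons w
    simp [hl] at hn
  | succ n ih =>
    rcases eq_spine_zero_or_exists_parent w with rfl | ⟨p, hp⟩
    · simp only [pathToRoot, spinePath, List.mem_singleton] at h
      subst h
      exact List.suffix_rfl
    · rw [hp] at h hn
      rcases List.mem_cons.1 h with rfl | h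
      · exact List.suffix_rfl
      · rw [hp]
        exact (ih h (by simpa using hn)).trans (List.suffix_cons _ _)

lemma mem_pathToRoot_trans {u v w : Vertex} (h : u ∈ pathToRoot v) (h' : v ∈ pathToRoot w) :
    u ∈ pathToRoot w :=
  (pathToRoot_suffix_of_mem h').subset h

lemma spine_zero_mem_pathToRoot (v : Vertex) : Vertex.spine 0 ∈ pathToRoot v := by
  induction hn : (pathToRoot v).length generalizing v with
  | zero =>
    obtain ⟨l, hl⟩ := exists_pathToRoot_eq_cons v
    simp [hl] at hn
  | succ n ih =>
    rcases eq_spine_zero_or_exists_parent v with rfl | ⟨p, hp⟩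
    · exact mem_pathToRoot_self _
    · rw [hp] at hn ⊢
      exact List.mem_cons_of_mem _ (ih p (by simpa using hn))

/-- Distinct vertices with the same parent have no common descendant. -/
lemma eq_of_mem_pathToRoot_of_parent_eq {p v v' w : Vertex}
    (hv : pathToRoot v = v :: pathToRoot p) (hv' : pathToRoot v' = v' :: pathToRoot p)
    (h : v ∈ pathToRoot w) (h' : v' ∈ pathToRoot w) : v = v' := by
  have h1 := pathToRoot_suffix_of_mem h
  have h2 := pathToRoot_suffix_of_mem h'
  refine pathToRoot_injective ((List.suffix_of_suffix_length_le h1 h2 ?_).eq_of_length ?_) <;>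
    simp [hv, hv']

/-- A vertex is not a descendant of its children. -/
lemma notMem_pathToRoot_of_parent {p v : Vertex} (hv : pathToRoot v = v :: pathToRoot p) :
    v ∉ pathToRoot p := by
  intro h
  have := (pathToRoot_suffix_of_mem h).length_le
  rw [hv] at this
  simp at this

/-- A proper descendant of `v` has an ancestor whose parent is `v`. -/
lemma exists_child_of_mem_pathToRoot {v w : Vertex} (h : v ∈ pathToRoot w) (hne : v ≠ w) :
    ∃ x ∈ pathToRoot w, pathToRoot x = x :: pathToRoot v := by
  induction hn : (pathToRoot w).length generalizing w with
  | zero =>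
    obtain ⟨l, hl⟩ := exists_pathToRoot_eq_cons w
    simp [hl] at hn
  | succ n ih =>
    rcases eq_spine_zero_or_exists_parent w with rfl | ⟨p, hp⟩
    · simp only [pathToRoot, spinePath, List.mem_singleton] at h
      exact absurd h hne
    · rw [hp] at h hn
      by_cases hvp : v = p
      · subst hvp
        exact ⟨w, mem_pathToRoot_self w, hp⟩
      · obtain ⟨x, hx, hx'⟩ := ih ((List.mem_cons.1 h).resolve_left hne) hvp (by simpa using hn)
        exact ⟨x, by rw [hp]; exact List.mem_cons_of_mem _ hx, hx'⟩

section Tree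

variable (k : ℕ → ℕ) (c : ℕ → ℕ → Word → ℕ)

/-- The children of a vertex of Kesten's tree. -/
def kids : Vertex → Finset Vertex
  | Vertex.spine h =>
    insert (Vertex.spine (h + 1)) ((Finset.range (k h)).image fun i => Vertex.graft h i [])
  | Vertex.graft h i u =>
    ((Finset.univ : Finset (Fin 2)).filter fun j : Fin 2 => (j : ℕ) < c h i u).image
      fun j : Fin 2 => Vertex.graft h i (j :: u)

variable {k c}

lemma pathToRoot_of_mem_kids {v w : Vertex} (h : w ∈ kids k c v) :
    pathToRoot w = w :: pathToRoot v := by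
  rcases v with n | ⟨n, i, u⟩
  · simp only [kids, Finset.mem_insert, Finset.mem_image] at h
    rcases h with rfl | ⟨i, -, rfl⟩ <;> rfl
  · simp only [kids, Finset.mem_image] at h
    obtain ⟨j, -, rfl⟩ := h
    rfl

lemma mem_kestenTree_of_mem_kids {v w : Vertex} (hv : v ∈ kestenTree k c) (h : w ∈ kids k c v) :
    w ∈ kestenTree k c := by
  rcases v with n | ⟨n, i, u⟩
  · simp only [kids, Finset.mem_insert, Finset.mem_image, Finset.mem_range] at h
    rcases h with rfl | ⟨i, hi, rfl⟩
    · exact kestenTree.spine _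
    · exact kestenTree.graft _ _ _ hi familyTree.root
  · simp only [kids, Finset.mem_image, Finset.mem_filter] at h
    obtain ⟨j, ⟨-, hj⟩, rfl⟩ := h
    cases hv with
    | graft _ _ _ hi hu => exact kestenTree.graft _ _ _ hi (familyTree.child hu hj)

lemma mem_kids_of_parent {v w : Vertex} (hw : w ∈ kestenTree k c)
    (h : pathToRoot w = w :: pathToRoot v) : w ∈ kids k c v ∧ v ∈ kestenTree k c := by
  cases hw with
  | spine n =>
    cases n with
    | zero =>
      obtain ⟨l, hl⟩ := exists_pathToRoot_eq_cons v
      rw [hl] at h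
      simp [pathToRoot, spinePath] at h
    | succ n =>
      have : Vertex.spine n = v := pathToRoot_injective (List.cons.inj h).2
      subst this
      exact ⟨Finset.mem_insert_self _ _, kestenTree.spine _⟩
  | graft n i u hi hu =>
    cases hu with
    | root =>
      have : Vertex.spine n = v := pathToRoot_injective (List.cons.inj h).2
      subst this
      exact ⟨Finset.mem_insert_of_mem
        (Finset.mem_image.2 ⟨i, Finset.mem_range.2 hi, rfl⟩), kestenTree.spine _⟩
    | @child u j hu hj =>
      have : Vertex.graft n i u = v := pathToRoot_injective (List.cons.inj h).2
      subst this
      exact ⟨Finset.mem_image.2 ⟨j, Finset.mem_filter.2 ⟨Finset.mem_univ _, hj⟩, rfl⟩,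
        kestenTree.graft _ _ _ hi hu⟩

lemma mem_kestenTree_of_mem_pathToRoot {v w : Vertex} (hw : w ∈ kestenTree k c)
    (h : v ∈ pathToRoot w) : v ∈ kestenTree k c := by
  induction hn : (pathToRoot w).length generalizing w with
  | zero =>
    obtain ⟨l, hl⟩ := exists_pathToRoot_eq_cons w
    simp [hl] at hn
  | succ n ih =>
    rcases eq_spine_zero_or_exists_parent w with rfl | ⟨p, hp⟩
    · simp only [pathToRoot, spinePath, List.mem_singleton] at h
      exact h ▸ hw
    · rw [hp] at h hn
      rcases List.mem_cons.1 h with rfl | h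
      · exact hw
      · exact ih (mem_kids_of_parent hw hp).2 h (by simpa using hn)

/-! ### Parking and finite subtrees containing the root -/

/-- Sets of vertices which contain the whole path to the root of each of their elements: the empty
set, and the subtrees which contain the root. -/
def IsRooted (C : Finset Vertex) : Prop :=
  ∀ v ∈ C, ∀ w ∈ pathToRoot v, w ∈ C

lemma parkingSpot_eq_none_iff {occ : Finset Vertex} {v : Vertex} :
    parkingSpot occ v = none ↔ ∀ w ∈ pathToRoot v, w ∈ occ := by
  simp [parkingSpot, List.find?_eq_none]

/-- If all the cars of a list arrive in a rooted set `C`, then each of them takes up one place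
of `C`. -/
lemma AllPark.card_add_length_le {C : Finset Vertex} (hC : IsRooted C) {l : List Vertex}
    (hl : ∀ v ∈ l, v ∈ C) {occ : Finset Vertex} (hocc : occ ⊆ C) (h : AllPark occ l) :
    occ.card + l.length ≤ C.card := by
  induction l generalizing occ with
  | nil => simpa using Finset.card_le_card hocc
  | cons v l ih =>
    obtain ⟨s, hs, h⟩ := h
    have hs1 : s ∈ pathToRoot v := List.mem_of_find?_eq_some hs
    have hs2 : s ∉ occ := by simpa using List.find?_some hs
    have := ih (fun w hw => hl w (List.mem_cons_of_mem _ hw))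
      (Finset.insert_subset (hC v (hl v List.mem_cons_self) s hs1) hocc) h
    rw [Finset.card_insert_of_notMem hs2] at this
    simp only [List.length_cons]
    omega

lemma eq_of_mem_pathToRoot_of_mem_pathToRoot {v w : Vertex} (h : v ∈ pathToRoot w)
    (h' : w ∈ pathToRoot v) : v = w :=
  pathToRoot_injective ((pathToRoot_suffix_of_mem h).eq_of_length_le
    (pathToRoot_suffix_of_mem h').length_le)

lemma cons_eq_pathToRoot_of_suffix {v s : Vertex} {l : List Vertex}
    (h : s :: l <:+ pathToRoot v) : s :: l = pathToRoot s := by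
  induction hn : (pathToRoot v).length generalizing v with
  | zero =>
    obtain ⟨m, hm⟩ := exists_pathToRoot_eq_cons v
    simp [hm] at hn
  | succ n ih =>
    rcases eq_spine_zero_or_exists_parent v with rfl | ⟨p, hp⟩
    · simp only [pathToRoot, spinePath, List.suffix_cons_iff, List.suffix_nil] at h
      rcases h with h | h
      · obtain ⟨rfl, rfl⟩ := List.cons.inj h
        rfl
      · simp at h
    · rw [hp] at h hn
      rcases List.suffix_cons_iff.1 h with h | h
      · rw [h, (List.cons.inj h).1, hp]
      · exact ih h (by simpa using hn)

lemma parkingSpot_eq_some {occ : Finset Vertex} {v s : Vertex} (h : parkingSpot occ v = some s) :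
    s ∉ occ ∧ s ∈ pathToRoot v ∧ ∀ w ∈ pathToRoot v, s ∈ pathToRoot w → w ≠ s → w ∈ occ := by
  refine ⟨by simpa using List.find?_some h, List.mem_of_find?_eq_some h, fun w hw hs hne => ?_⟩
  obtain ⟨-, l₁, l₂, hv, hl⟩ := List.find?_eq_some_iff_append.1 h
  rw [hv, List.mem_append] at hw
  rcases hw with hw | hw
  · simpa using hl w hw
  · rw [cons_eq_pathToRoot_of_suffix (v := v) (hv ▸ List.suffix_append _ _)] at hw
    exact absurd (eq_of_mem_pathToRoot_of_mem_pathToRoot hw hs) hne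

/-- If `D` contains the parking spot `s` of a car and is closed under passing to occupied children,
then the car has arrived in `D`, as it has only driven through occupied vertices before `s`. -/
lemma mem_of_parkingSpot_mem {D occ : Finset Vertex} {v s : Vertex}
    (hs : parkingSpot occ v = some s)
    (hD : ∀ w ∈ occ, ∀ p ∈ D, pathToRoot w = w :: pathToRoot p → w ∈ D)
    (hsD : s ∈ D) : v ∈ D := by
  obtain ⟨-, hsv, hocc⟩ := parkingSpot_eq_some hs
  have key : ∀ n w, (pathToRoot w).length = n → w ∈ pathToRoot v → s ∈ pathToRoot w → w ∈ D := by
    intro n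
    induction n with
    | zero =>
      intro w hn
      obtain ⟨m, hm⟩ := exists_pathToRoot_eq_cons w
      simp [hm] at hn
    | succ n ih =>
      intro w hn hw hsw
      by_cases hne : w = s
      · exact hne ▸ hsD
      have hwo := hocc w hw hsw hne
      rcases eq_spine_zero_or_exists_parent w with rfl | ⟨p, hp⟩
      · exact absurd (List.mem_singleton.1 hsw).symm hne
      · rw [hp] at hn hsw
        refine hD w hwo p (ih p (by simpa using hn) (mem_pathToRoot_trans ?_ hw)
          ((List.mem_cons.1 hsw).resolve_left (Ne.symm hne))) hp
        rw [hp]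
        exact List.mem_cons_of_mem _ (mem_pathToRoot_self p)
  exact key _ v rfl (mem_pathToRoot_self v) hsv

/-- The cars of `m` have arrived and occupy `occ`; the hypothesis on them says that the cars
parked in a union of connected components of `occ` (or, more generally, in a set closed under
passing to occupied children) have arrived in it. If no rooted set receives more cars than it has
places, then the cars of `l` can park as well: a car that does not would have arrived in the
connected component of the root in `occ`, which the previous cars have filled. -/
lemma allPark_of_sum_le_card {a : Vertex → ℕ}
    (ha : ∀ C : Finset Vertex, IsRooted C → (∀ v ∈ C, v ∈ kestenTree k c) →
      ∑ v ∈ C, a v ≤ C.card)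
    {l m : List Vertex} {occ : Finset Vertex}
    (hm : ∀ D ⊆ occ, (∀ w ∈ occ, ∀ p ∈ D, pathToRoot w = w :: pathToRoot p → w ∈ D) →
      D.card ≤ ∑ v ∈ D, m.count v)
    (hocc : ∀ v ∈ occ, v ∈ kestenTree k c) (hl : ∀ v ∈ l, v ∈ kestenTree k c)
    (hcount : ∀ v, m.count v + l.count v ≤ a v) : AllPark occ l := by
  induction l generalizing m occ with
  | nil => trivial
  | cons v l ih =>
    rcases hs : parkingSpot occ v with _ | s
    · exfalso
      rw [parkingSpot_eq_none_iff] at hs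
      set C := occ.filter fun w => ∀ x ∈ pathToRoot w, x ∈ occ with hCdef
      have hvC : v ∈ C := Finset.mem_filter.2 ⟨hs v (mem_pathToRoot_self v), hs⟩
      have h1 := hm C (Finset.filter_subset _ _) (by
        intro w hw p hp hwp
        refine Finset.mem_filter.2 ⟨hw, ?_⟩
        rw [hwp]
        intro x hx
        rcases List.mem_cons.1 hx with rfl | hx
        · exact hw
        · exact (Finset.mem_filter.1 hp).2 x hx)
      have h2 := ha C (by
        intro w hw x hx
        have hw' := (Finset.mem_filter.1 hw).2
        exact Finset.mem_filter.2 ⟨hw' x hx, fun y hy => hw' y (mem_pathToRoot_trans hy hx)⟩)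
        (fun w hw => hocc w (Finset.mem_filter.1 hw).1)
      have h3 : ∑ w ∈ C, m.count w < ∑ w ∈ C, a w := by
        refine Finset.sum_lt_sum (fun w _ => ?_) ⟨v, hvC, ?_⟩
        · have := hcount w
          omega
        · have := hcount v
          rw [List.count_cons_self] at this
          omega
      omega
    · refine ⟨s, hs, ih (m := v :: m) ?_ ?_ (fun w hw => hl w (List.mem_cons_of_mem _ hw)) ?_⟩
      · intro D hD hDc
        have hle : ∀ E : Finset Vertex, ∑ w ∈ E, m.count w ≤ ∑ w ∈ E, (v :: m).count w :=
          fun E => Finset.sum_le_sum fun w _ => by rw [List.count_cons]; omega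
        by_cases hsD : s ∈ D
        · have hsocc := (parkingSpot_eq_some hs).1
          have hvD : v ∈ D := mem_of_parkingSpot_mem hs
            (fun w hw p hp hwp => hDc w (Finset.mem_insert_of_mem hw) p hp hwp) hsD
          have h1 := hm (D.erase s) (by
            intro w hw
            obtain ⟨hws, hw⟩ := Finset.mem_erase.1 hw
            exact (Finset.mem_insert.1 (hD hw)).resolve_left hws) (by
            intro w hw p hp hwp
            refine Finset.mem_erase.2 ⟨fun h => hsocc (h ▸ hw), ?_⟩
            exact hDc w (Finset.mem_insert_of_mem hw) p (Finset.mem_erase.1 hp).2 hwp)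
          have h2 : ∑ w ∈ D.erase s, m.count w ≤ ∑ w ∈ D, m.count w :=
            Finset.sum_le_sum_of_subset (Finset.erase_subset _ _)
          have h3 : ∑ w ∈ D, m.count w < ∑ w ∈ D, (v :: m).count w :=
            Finset.sum_lt_sum (fun w _ => by rw [List.count_cons]; omega)
              ⟨v, hvD, by rw [List.count_cons_self]; omega⟩
          have h4 := Finset.card_erase_add_one hsD
          omega
        · refine (hm D ?_ ?_).trans (hle D)
          · intro w hw
            exact (Finset.mem_insert.1 (hD hw)).resolve_left fun h => hsD (h ▸ hw)
          · exact fun w hw => hDc w (Finset.mem_insert_of_mem hw)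
      · intro w hw
        rcases Finset.mem_insert.1 hw with rfl | hw
        · exact mem_kestenTree_of_mem_pathToRoot (hl v List.mem_cons_self)
            (parkingSpot_eq_some hs).2.1
        · exact hocc w hw
      · intro w
        have := hcount w
        rw [List.count_cons] at this ⊢
        omega

/-- All cars park if and only if no finite subtree containing the root receives more cars than it has
vertices. -/
lemma allCarsPark_iff_sum_le_card {a : Vertex → ℕ} :
    AllCarsPark (kestenTree k c) a ↔
      ∀ C : Finset Vertex, IsRooted C → (∀ v ∈ C, v ∈ kestenTree k c) →
        ∑ v ∈ C, a v ≤ C.card := by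
  refine ⟨fun h C hC hCt => ?_, fun h l hl hc => ?_⟩
  · -- the list of all the cars that arrive in `C`
    set l := (∑ v ∈ C, Multiset.replicate (a v) v).toList with hldef
    have hl : ∀ v ∈ l, v ∈ C := by
      intro v hv
      rw [hldef, Multiset.mem_toList, Multiset.mem_sum] at hv
      obtain ⟨w, hw, hv⟩ := hv
      exact Multiset.eq_of_mem_replicate hv ▸ hw
    have hlen : l.length = ∑ v ∈ C, a v := by
      simp [hldef]
    have hpark := h l (fun v hv => hCt v (hl v hv)) (by
      intro v
      rw [hldef, ← Multiset.coe_count, Multiset.coe_toList, Multiset.count_sum']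
      simp only [Multiset.count_replicate]
      rw [Finset.sum_ite_eq' C v]
      split_ifs <;> omega)
    have := hpark.card_add_length_le hC hl (Finset.empty_subset _)
    simpa [hlen] using this
  · refine allPark_of_sum_le_card (m := []) h ?_ (by simp) hl (by simpa using hc)
    intro D hD
    simp [Finset.subset_empty.1 hD]

/-! ### The flow of cars -/

variable (k c) in
/-- The number of cars that visit `v`, parked there or not, if cars arrive only at the descendants
of `v` which are less than `n` generations apart from `v`. -/
def flow (a : Vertex → ℕ) : ℕ → Vertex → ℕ
  | 0, _ => 0
  | n + 1, v => a v + ∑ w ∈ kids k c v, (flow a n w - 1)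

variable {a : Vertex → ℕ}

lemma flow_succ (n : ℕ) (v : Vertex) :
    flow k c a (n + 1) v = a v + ∑ w ∈ kids k c v, (flow k c a n w - 1) := rfl

lemma flow_le_flow_succ (n : ℕ) (v : Vertex) : flow k c a n v ≤ flow k c a (n + 1) v := by
  induction n generalizing v with
  | zero => exact Nat.zero_le _
  | succ n ih =>
    rw [flow_succ, flow_succ (n + 1)]
    gcongr
    exact ih _

/-- The part above `v` of a finite subtree containing the root has a surplus of cars of at most
`flow - 1`, where the flow at `v` is computed to a depth which exhausts the subtree. -/
lemma sum_descendants_le_flow {C : Finset Vertex} (hC : IsRooted C)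
    (hCt : ∀ v ∈ C, v ∈ kestenTree k c) (n : ℕ) (v : Vertex)
    (hn : ∀ w ∈ C, v ∈ pathToRoot w → (pathToRoot w).length < (pathToRoot v).length + n) :
    ∑ w ∈ C with v ∈ pathToRoot w, ((a w : ℤ) - 1) ≤ ((flow k c a n v - 1 : ℕ) : ℤ) := by
  induction n generalizing v with
  | zero =>
    rw [Finset.sum_eq_zero]
    · positivity
    · intro w hw
      obtain ⟨hw, hvw⟩ := Finset.mem_filter.1 hw
      have := (pathToRoot_suffix_of_mem hvw).length_le
      have := hn w hw hvw
      omega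
  | succ n ih =>
    by_cases hv : v ∈ C
    · have hset : (C.filter fun w => v ∈ pathToRoot w) =
          insert v ((kids k c v).biUnion fun x => C.filter fun w => x ∈ pathToRoot w) := by
        ext w
        simp only [Finset.mem_filter, Finset.mem_insert, Finset.mem_biUnion]
        constructor
        · rintro ⟨hw, hvw⟩
          by_cases hne : v = w
          · exact Or.inl hne.symm
          · obtain ⟨x, hx, hxv⟩ := exists_child_of_mem_pathToRoot hvw hne
            exact Or.inr ⟨x, (mem_kids_of_parent
              (mem_kestenTree_of_mem_pathToRoot (hCt w hw) hx) hxv).1, hw, hx⟩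
        · rintro (rfl | ⟨x, hx, hw, hxw⟩)
          · exact ⟨hv, mem_pathToRoot_self _⟩
          · refine ⟨hw, mem_pathToRoot_trans ?_ hxw⟩
            rw [pathToRoot_of_mem_kids hx]
            exact List.mem_cons_of_mem _ (mem_pathToRoot_self v)
      rw [hset, Finset.sum_insert, Finset.sum_biUnion]
      · have hsum : ∑ x ∈ kids k c v, ∑ w ∈ C with x ∈ pathToRoot w, ((a w : ℤ) - 1) ≤
            ∑ x ∈ kids k c v, ((flow k c a n x - 1 : ℕ) : ℤ) := by
          refine Finset.sum_le_sum fun x hx => ih x fun w hw hxw => ?_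
          have := hn w hw (mem_pathToRoot_trans (by
            rw [pathToRoot_of_mem_kids hx]
            exact List.mem_cons_of_mem _ (mem_pathToRoot_self v)) hxw)
          rw [pathToRoot_of_mem_kids hx, List.length_cons]
          omega
        rw [← Nat.cast_sum] at hsum
        rw [flow_succ]
        omega
      · intro x hx y hy hxy
        rw [Function.onFun, Finset.disjoint_left]
        intro w hw hw'
        exact hxy (eq_of_mem_pathToRoot_of_parent_eq (pathToRoot_of_mem_kids hx)
          (pathToRoot_of_mem_kids hy) (Finset.mem_filter.1 hw).2 (Finset.mem_filter.1 hw').2)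
      · simp only [Finset.mem_biUnion, Finset.mem_filter, not_exists, not_and]
        exact fun x hx _ => notMem_pathToRoot_of_parent (pathToRoot_of_mem_kids hx)
    · rw [Finset.sum_eq_zero]
      · positivity
      · intro w hw
        obtain ⟨hw, hvw⟩ := Finset.mem_filter.1 hw
        exact absurd (hC w hw v hvw) hv

/-- The flow at `v` is attained by a finite set of descendants of `v`, which is empty or a subtree
containing `v`. -/
lemma exists_flow_le_sum (n : ℕ) {v : Vertex} (hv : v ∈ kestenTree k c) :
    ∃ C : Finset Vertex,
      (∀ w ∈ C, w ∈ kestenTree k c ∧ v ∈ pathToRoot w) ∧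
      (∀ w ∈ C, ∀ x ∈ pathToRoot w, v ∈ pathToRoot x → x ∈ C) ∧
      (flow k c a n v : ℤ) - 1 ≤ ∑ w ∈ C, ((a w : ℤ) - 1) := by
  induction n generalizing v with
  | zero => exact ⟨∅, by simp, by simp, by simp [flow]⟩
  | succ n ih =>
    have hkids : ∀ x ∈ kids k c v, v ∈ pathToRoot x := fun x hx => by
      rw [pathToRoot_of_mem_kids hx]
      exact List.mem_cons_of_mem _ (mem_pathToRoot_self v)
    have ih' : ∀ x, ∃ C : Finset Vertex, x ∈ kids k c v →
        (∀ w ∈ C, w ∈ kestenTree k c ∧ x ∈ pathToRoot w) ∧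
        (∀ w ∈ C, ∀ y ∈ pathToRoot w, x ∈ pathToRoot y → y ∈ C) ∧
        ((flow k c a n x - 1 : ℕ) : ℤ) ≤ ∑ w ∈ C, ((a w : ℤ) - 1) := by
      intro x
      by_cases hx : x ∈ kids k c v
      · by_cases h0 : flow k c a n x = 0
        · exact ⟨∅, fun _ => ⟨by simp, by simp, by simp [h0]⟩⟩
        · obtain ⟨C, h1, h2, h3⟩ := ih (mem_kestenTree_of_mem_kids hv hx)
          exact ⟨C, fun _ => ⟨h1, h2, by omega⟩⟩
      · exact ⟨∅, fun h => absurd h hx⟩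
    choose C hC using ih'
    refine ⟨insert v ((kids k c v).biUnion C), ?_, ?_, ?_⟩
    · intro w hw
      rcases Finset.mem_insert.1 hw with rfl | hw
      · exact ⟨hv, mem_pathToRoot_self _⟩
      · obtain ⟨x, hx, hw⟩ := Finset.mem_biUnion.1 hw
        exact ⟨((hC x hx).1 w hw).1, mem_pathToRoot_trans (hkids x hx) ((hC x hx).1 w hw).2⟩
    · intro w hw y hy hvy
      rcases Finset.mem_insert.1 hw with rfl | hw
      · rw [eq_of_mem_pathToRoot_of_mem_pathToRoot hy hvy]
        exact Finset.mem_insert_self _ _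
      · by_cases hne : v = y
        · exact hne ▸ Finset.mem_insert_self _ _
        obtain ⟨x, hx, hw⟩ := Finset.mem_biUnion.1 hw
        have hwC := (hC x hx).1 w hw
        obtain ⟨x', hx', hx'v⟩ := exists_child_of_mem_pathToRoot hvy hne
        obtain rfl : x = x' := eq_of_mem_pathToRoot_of_parent_eq (pathToRoot_of_mem_kids hx)
          hx'v hwC.2 (mem_pathToRoot_trans hx' hy)
        exact Finset.mem_insert_of_mem (Finset.mem_biUnion.2 ⟨x, hx, (hC x hx).2.1 w hw y hy hx'⟩)
    · rw [Finset.sum_insert, Finset.sum_biUnion]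
      · have := Finset.sum_le_sum fun x hx => (hC x hx).2.2
        rw [← Nat.cast_sum] at this
        rw [flow_succ]
        push_cast at this ⊢
        linarith
      · intro x hx y hy hxy
        rw [Function.onFun, Finset.disjoint_left]
        intro w hw hw'
        exact hxy (eq_of_mem_pathToRoot_of_parent_eq (pathToRoot_of_mem_kids hx)
          (pathToRoot_of_mem_kids hy) ((hC x hx).1 w hw).2 ((hC y hy).1 w hw').2)
      · simp only [Finset.mem_biUnion, not_exists, not_and]
        exact fun x hx h =>
          notMem_pathToRoot_of_parent (pathToRoot_of_mem_kids hx) ((hC x hx).1 v h).2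

/-- All cars park if and only if the root is visited by at most one car, however many generations
are taken into account. -/
theorem allCarsPark_iff_flow_le_one :
    AllCarsPark (kestenTree k c) a ↔ ∀ n, flow k c a n (Vertex.spine 0) ≤ 1 := by
  rw [allCarsPark_iff_sum_le_card]
  constructor
  · intro h n
    obtain ⟨C, h1, h2, h3⟩ := exists_flow_le_sum (a := a) n (kestenTree.spine (k := k) (c := c) 0)
    have := h C (fun w hw x hx => h2 w hw x hx (spine_zero_mem_pathToRoot x))
      fun w hw => (h1 w hw).1
    rw [Finset.sum_sub_distrib, ← Nat.cast_sum, Finset.sum_const, nsmul_eq_mul, mul_one] at h3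
    omega
  · intro h C hC hCt
    have h1 := sum_descendants_le_flow (a := a) hC hCt
      (C.sup fun w => (pathToRoot w).length) (Vertex.spine 0) (by
        intro w hw _
        have := Finset.le_sup (f := fun w => (pathToRoot w).length) hw
        simp only [pathToRoot, spinePath, List.length_singleton] at this ⊢
        omega)
    have h2 := h (C.sup fun w => (pathToRoot w).length)
    rw [Finset.filter_true_of_mem fun w _ => spine_zero_mem_pathToRoot w,
      Finset.sum_sub_distrib, ← Nat.cast_sum, Finset.sum_const, nsmul_eq_mul, mul_one] at h1
    omega

lemma flow_graft_succ (n h i : ℕ) (u : Word) :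
    flow k c a (n + 1) (Vertex.graft h i u) = a (Vertex.graft h i u) +
      ∑ j : Fin 2, if (j : ℕ) < c h i u then flow k c a n (Vertex.graft h i (j :: u)) - 1 else 0 := by
  rw [flow_succ, kids, Finset.sum_image, Finset.sum_filter]
  intro x _ y _ hxy
  simpa using hxy

lemma flow_spine_succ (n h : ℕ) :
    flow k c a (n + 1) (Vertex.spine h) = a (Vertex.spine h) +
      ((flow k c a n (Vertex.spine (h + 1)) - 1) +
        ∑ i ∈ Finset.range (k h), (flow k c a n (Vertex.graft h i []) - 1)) := by
  rw [flow_succ, kids, Finset.sum_insert, Finset.sum_image]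
  · intro x _ y _ hxy
    simpa using hxy
  · simp

end Tree

/-! ### Analysis of the recursion for the generating functions -/

section Analysis

open Filter Topology Set

/-- The second order term of the expansion of `x ^ 2 * exp (α * (1 - x))` at `1`. -/
lemma tendsto_exp_expansion (α : ℝ) :
    Tendsto (fun x : ℝ => (x ^ 2 * Real.exp (α * (1 - x)) - 1 + (2 - α) * (1 - x)) / (1 - x) ^ 2)
      (𝓝[<] 1) (𝓝 ((α ^ 2 - 4 * α + 2) / 2)) := by
  have hy : Tendsto (fun x : ℝ => 1 - x) (𝓝[<] 1) (𝓝 0) := by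
    have : Tendsto (fun x : ℝ => 1 - x) (𝓝 1) (𝓝 (1 - 1)) := by
      exact (continuous_const.sub continuous_id).tendsto 1
    rw [sub_self] at this
    exact this.mono_left nhdsWithin_le_nhds
  have hz : Tendsto (fun x : ℝ => α * (1 - x)) (𝓝[<] 1) (𝓝 0) := by
    simpa using hy.const_mul α
  have hR : (fun x : ℝ => Real.exp (α * (1 - x)) - 1 - α * (1 - x) - (α * (1 - x)) ^ 2 / 2)
      =o[𝓝[<] 1] fun x => (1 - x) ^ 2 := by
    have h := (Real.exp_sub_sum_range_succ_isLittleO_pow 2).comp_tendsto hz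
    have h2 : ((fun x : ℝ => x ^ 2) ∘ fun x => α * (1 - x)) =O[𝓝[<] 1] fun x => (1 - x) ^ 2 := by
      refine Asymptotics.IsBigO.of_bound (α ^ 2) (Eventually.of_forall fun x => ?_)
      simp [mul_pow]
    refine (h.trans_isBigO h2).congr_left fun x => ?_
    simp [Finset.sum_range_succ, Nat.factorial]
    ring
  have hR' := hR.tendsto_div_nhds_zero
  have hx : Tendsto (fun x : ℝ => x) (𝓝[<] 1) (𝓝 1) := tendsto_id.mono_left nhdsWithin_le_nhds
  have key := ((hy.const_mul (α - α ^ 2)).add ((hy.pow 2).const_mul (α ^ 2 / 2))).add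
    ((hx.pow 2).mul hR') |>.const_add ((α ^ 2 - 4 * α + 2) / 2)
  simp only [mul_zero, zero_pow two_ne_zero, add_zero] at key
  refine key.congr' ?_
  filter_upwards [self_mem_nhdsWithin] with x hx
  have : (1 - x) ≠ 0 := (sub_pos.2 hx).ne'
  field_simp
  ring

lemma strictConvexOn_sq_mul_exp {α : ℝ} (hα : 0 ≤ α) (hα' : α ≤ 2 - √2) :
    StrictConvexOn ℝ (Icc 0 1) fun x : ℝ => x ^ 2 * Real.exp (α * (1 - x)) := by
  have hexp : ∀ x : ℝ, HasDerivAt (fun x : ℝ => Real.exp (α * (1 - x)))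
      (-α * Real.exp (α * (1 - x))) x := fun x => by
    have h1 : HasDerivAt (fun x : ℝ => α * (1 - x)) (α * (0 - 1)) x :=
      ((hasDerivAt_const x (1 : ℝ)).sub (hasDerivAt_id x)).const_mul α
    convert h1.exp using 1
    ring
  have hd : ∀ x : ℝ, HasDerivAt (fun x : ℝ => x ^ 2 * Real.exp (α * (1 - x)))
      ((2 * x - α * x ^ 2) * Real.exp (α * (1 - x))) x := fun x => by
    refine ((hasDerivAt_pow 2 x).fun_mul (hexp x)).congr_deriv ?_
    simp only [Nat.cast_ofNat, Nat.add_one_sub_one, pow_one]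
    ring
  have hd2 : ∀ x : ℝ, HasDerivAt (fun x : ℝ => (2 * x - α * x ^ 2) * Real.exp (α * (1 - x)))
      ((2 - 4 * (α * x) + (α * x) ^ 2) * Real.exp (α * (1 - x))) x := fun x => by
    have h1 : HasDerivAt (fun x : ℝ => 2 * x - α * x ^ 2) (2 - α * (2 * x)) x := by
      have := ((hasDerivAt_id' x).const_mul 2).fun_sub ((hasDerivAt_pow 2 x).const_mul α)
      simpa using this
    refine (h1.fun_mul (hexp x)).congr_deriv ?_
    ring
  refine strictConvexOn_of_deriv2_pos (convex_Icc 0 1)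
    (fun x _ => (hd x).continuousAt.continuousWithinAt) fun x hx => ?_
  rw [interior_Icc] at hx
  have h1 : deriv (fun x : ℝ => x ^ 2 * Real.exp (α * (1 - x))) =
      fun x => (2 * x - α * x ^ 2) * Real.exp (α * (1 - x)) := funext fun x => (hd x).deriv
  rw [Function.iterate_succ, Function.iterate_one, Function.comp_apply, h1, (hd2 x).deriv]
  refine mul_pos ?_ (Real.exp_pos _)
  have h2 : √2 ^ 2 = 2 := Real.sq_sqrt (by norm_num)
  have h3 : 0 < √2 := by positivity
  have h4 : α * x < 2 - √2 := by
    rcases hα.eq_or_lt with rfl | hα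
    · nlinarith
    · nlinarith [mul_lt_mul_of_pos_left hx.2 hα]
  nlinarith

/-- The properties of the limit `Γ` of the generating functions of the flow at the root of the
truncated Galton-Watson trees that matter in the sequel. The equation is the functional equation
of the generating function after completing the square. -/
structure IsFlowLimit (α : ℝ) (Γ : ℝ → ℝ) : Prop where
  nonneg : 0 ≤ α
  le_one : ∀ x ∈ Icc (0 : ℝ) 1, Γ x ≤ 1
  pos_zero : 0 < Γ 0
  mono : MonotoneOn Γ (Icc 0 1)
  lipschitz : ∀ x ∈ Icc (0 : ℝ) 1, ∀ y ∈ Icc (0 : ℝ) 1, x ≤ y → (1 - x) * (Γ y - Γ x) ≤ y - x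
  sq_eq : ∀ x ∈ Icc (0 : ℝ) 1, (√(Γ x) - x * Real.exp (α * (1 - x) / 2)) ^ 2 =
    x ^ 2 * Real.exp (α * (1 - x)) - x + (1 - x) * Γ 0

namespace IsFlowLimit

variable {α : ℝ} {Γ : ℝ → ℝ}

lemma continuousOn (h : IsFlowLimit α Γ) {b : ℝ} (hb : b < 1) : ContinuousOn Γ (Icc 0 b) := by
  have hb' : 0 < 1 - b := sub_pos.2 hb
  have key : ∀ x ∈ Icc 0 b, ∀ y ∈ Icc 0 b, x ≤ y → |Γ y - Γ x| ≤ 1 / (1 - b) * |y - x| := by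
    intro x hx y hy hxy
    have hx' : x ∈ Icc (0 : ℝ) 1 := ⟨hx.1, hx.2.trans hb.le⟩
    have hy' : y ∈ Icc (0 : ℝ) 1 := ⟨hy.1, hy.2.trans hb.le⟩
    have h1 := h.mono hx' hy' hxy
    have h2 := h.lipschitz x hx' y hy' hxy
    rw [abs_of_nonneg (sub_nonneg.2 h1), abs_of_nonneg (sub_nonneg.2 hxy), one_div,
      ← div_eq_inv_mul, le_div_iff₀ hb']
    nlinarith [hx.2]
  refine (LipschitzOnWith.of_dist_le_mul (K := ⟨1 / (1 - b), by positivity⟩)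
    fun x hx y hy => ?_).continuousOn
  rw [Real.dist_eq, Real.dist_eq]
  rcases le_total x y with hxy | hxy
  · rw [abs_sub_comm, abs_sub_comm x]
    exact key x hx y hy hxy
  · exact key y hy x hx hxy

/-- For `α ≤ 2 - √2` the right hand side of `sq_eq` is strictly convex, so that it has no zero
besides `1`, and the square root on the left hand side keeps the sign which it has at `0`. -/
lemma lt_sqrt (h : IsFlowLimit α Γ) (hα : α ≤ 2 - √2) {x : ℝ} (hx : x ∈ Ico (0 : ℝ) 1) :
    x * Real.exp (α * (1 - x) / 2) < √(Γ x) := by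
  by_contra! hle
  have hcont : ContinuousOn (fun x => √(Γ x) - x * Real.exp (α * (1 - x) / 2)) (Icc 0 x) :=
    (h.continuousOn hx.2).sqrt.sub (by fun_prop)
  obtain ⟨z, hz, hz0⟩ := intermediate_value_Icc' hx.1 hcont
    (show (0 : ℝ) ∈ _ from ⟨sub_nonpos.2 hle, by simp⟩)
  have hz1 : z < 1 := hz.2.trans_lt hx.2
  have hD := h.sq_eq z ⟨hz.1, hz1.le⟩
  dsimp only at hz0
  rw [hz0] at hD
  have hconv := (strictConvexOn_sq_mul_exp h.nonneg hα).2 ⟨hz.1, hz1.le⟩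
    ⟨zero_le_one, le_rfl⟩ hz1.ne (by norm_num : (0 : ℝ) < 1 / 2) (by norm_num : (0 : ℝ) < 1 / 2)
    (by norm_num)
  have hm := h.sq_eq ((1 / 2 : ℝ) • z + (1 / 2 : ℝ) • 1) (by
    constructor <;> simp only [smul_eq_mul] <;> linarith [hz.1])
  have hpos := sq_nonneg (√(Γ ((1 / 2 : ℝ) • z + (1 / 2 : ℝ) • 1)) -
    ((1 / 2 : ℝ) • z + (1 / 2 : ℝ) • 1) *
      Real.exp (α * (1 - ((1 / 2 : ℝ) • z + (1 / 2 : ℝ) • 1)) / 2))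
  rw [hm] at hpos
  simp only [smul_eq_mul, sub_self, mul_zero, Real.exp_zero] at hconv hpos
  linarith

/-- If the square root in `sq_eq` is positive on `(0, 1)`, it is at most `1 - x`, so that the
linear term of the expansion of its square at `1` vanishes. -/
lemma zero_eq_and_tendsto (h : IsFlowLimit α Γ)
    (hpos : ∀ x ∈ Ioo (0 : ℝ) 1, x * Real.exp (α * (1 - x) / 2) < √(Γ x)) :
    Γ 0 = 1 - α ∧ 0 ≤ (α ^ 2 - 4 * α + 2) / 2 ∧
    Tendsto (fun x => (√(Γ x) - x * Real.exp (α * (1 - x) / 2)) / (1 - x)) (𝓝[<] 1)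
      (𝓝 √((α ^ 2 - 4 * α + 2) / 2)) := by
  have hmem : ∀ᶠ x : ℝ in 𝓝[<] 1, x ∈ Ioo (0 : ℝ) 1 :=
    Ioo_mem_nhdsLT (by norm_num)
  have hE := tendsto_exp_expansion α
  have hy : Tendsto (fun x : ℝ => 1 - x) (𝓝[<] 1) (𝓝 0) := by
    have : Tendsto (fun x : ℝ => 1 - x) (𝓝 1) (𝓝 (1 - 1)) :=
      (continuous_const.sub continuous_id).tendsto 1
    rw [sub_self] at this
    exact this.mono_left nhdsWithin_le_nhds
  have hg : Γ 0 = 1 - α := by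
    have h1 := (hy.mul hE).add_const (α + Γ 0 - 1)
    rw [zero_mul, zero_add] at h1
    have heq : (fun x : ℝ => (√(Γ x) - x * Real.exp (α * (1 - x) / 2)) ^ 2 / (1 - x)) =ᶠ[𝓝[<] 1]
        fun x => (1 - x) * ((x ^ 2 * Real.exp (α * (1 - x)) - 1 + (2 - α) * (1 - x)) /
          (1 - x) ^ 2) + (α + Γ 0 - 1) := by
      filter_upwards [hmem] with x hx
      rw [h.sq_eq x ⟨hx.1.le, hx.2.le⟩]
      have : (1 - x) ≠ 0 := (sub_pos.2 hx.2).ne'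
      field_simp
      ring
    have h2 : Tendsto (fun x : ℝ => (√(Γ x) - x * Real.exp (α * (1 - x) / 2)) ^ 2 / (1 - x))
        (𝓝[<] 1) (𝓝 0) := by
      refine squeeze_zero' ?_ ?_ hy
      · filter_upwards [hmem] with x hx
        have : 0 < 1 - x := sub_pos.2 hx.2
        positivity
      · filter_upwards [hmem] with x hx
        have hx1 : 0 < 1 - x := sub_pos.2 hx.2
        have h3 : √(Γ x) ≤ 1 := Real.sqrt_le_one.2 (h.le_one x ⟨hx.1.le, hx.2.le⟩)
        have h4 : 1 ≤ Real.exp (α * (1 - x) / 2) :=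
          Real.one_le_exp (by have := h.nonneg; positivity)
        have h5 := hpos x hx
        have h6 : x ≤ x * Real.exp (α * (1 - x) / 2) := le_mul_of_one_le_right hx.1.le h4
        rw [div_le_iff₀ hx1]
        nlinarith
    have := tendsto_nhds_unique h2 (h1.congr' heq.symm)
    linarith
  have heq : (fun x : ℝ => ((√(Γ x) - x * Real.exp (α * (1 - x) / 2)) / (1 - x)) ^ 2) =ᶠ[𝓝[<] 1]
      fun x => (x ^ 2 * Real.exp (α * (1 - x)) - 1 + (2 - α) * (1 - x)) / (1 - x) ^ 2 := by
    filter_upwards [hmem] with x hx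
    rw [div_pow, h.sq_eq x ⟨hx.1.le, hx.2.le⟩, hg]
    ring
  have hE' := hE.congr' heq.symm
  refine ⟨hg, ge_of_tendsto hE' (Eventually.of_forall fun x => sq_nonneg _), ?_⟩
  refine hE'.sqrt.congr' ?_
  filter_upwards [hmem] with x hx
  exact Real.sqrt_sq (div_nonneg (sub_nonneg.2 (hpos x hx).le) (sub_nonneg.2 hx.2.le))

end IsFlowLimit

/-- The recursion satisfied by the generating functions `G n` of the flow `X` at the root of a
Galton-Watson tree truncated at depth `n`, `H n` of `X - 1`, and `W n` of `Y - 1` (differences in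
`ℕ`), where `Y` is the flow at the root of the truncated Kesten tree. -/
structure FlowRecursion (α : ℝ) (G H W : ℕ → ℝ → ℝ) : Prop where
  nonneg : 0 ≤ α
  mul_H : ∀ n, ∀ x ∈ Icc (0 : ℝ) 1, x * H n x = G n x - (1 - x) * G n 0
  G_succ : ∀ n, ∀ x ∈ Icc (0 : ℝ) 1,
    G (n + 1) x = Real.exp (-(α * (1 - x))) * ((1 + H n x) / 2) ^ 2
  mul_W_succ : ∀ n, ∀ x ∈ Icc (0 : ℝ) 1,
    x * W (n + 1) x = Real.exp (-(α * (1 - x))) * ((1 + H n x) / 2) * W n x -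
      (1 - x) * (Real.exp (-α) * ((1 + H n 0) / 2) * W n 0)
  G_anti : ∀ x ∈ Icc (0 : ℝ) 1, Antitone fun n => G n x
  W_anti : ∀ x ∈ Icc (0 : ℝ) 1, Antitone fun n => W n x
  G_nonneg : ∀ n, ∀ x ∈ Icc (0 : ℝ) 1, 0 ≤ G n x
  G_le_one : ∀ n, ∀ x ∈ Icc (0 : ℝ) 1, G n x ≤ 1
  H_nonneg : ∀ n, ∀ x ∈ Icc (0 : ℝ) 1, 0 ≤ H n x
  W_nonneg : ∀ n, ∀ x ∈ Icc (0 : ℝ) 1, 0 ≤ W n x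
  W_le_one : ∀ n, ∀ x ∈ Icc (0 : ℝ) 1, W n x ≤ 1
  G_mono : ∀ n, MonotoneOn (G n) (Icc 0 1)
  G_lipschitz : ∀ n, ∀ x ∈ Icc (0 : ℝ) 1, ∀ y ∈ Icc (0 : ℝ) 1, x ≤ y →
    (1 - x) * (G n y - G n x) ≤ y - x
  W_tendsto : ∀ n, Tendsto (W n) (𝓝[<] 1) (𝓝 1)

namespace FlowRecursion

variable {α : ℝ} {G H W : ℕ → ℝ → ℝ}

lemma tendsto_G (h : FlowRecursion α G H W) {x : ℝ} (hx : x ∈ Icc (0 : ℝ) 1) :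
    Tendsto (fun n => G n x) atTop (𝓝 (⨅ n, G n x)) :=
  tendsto_atTop_ciInf (h.G_anti x hx) ⟨0, by rintro _ ⟨n, rfl⟩; exact h.G_nonneg n x hx⟩

lemma tendsto_W (h : FlowRecursion α G H W) {x : ℝ} (hx : x ∈ Icc (0 : ℝ) 1) :
    Tendsto (fun n => W n x) atTop (𝓝 (⨅ n, W n x)) :=
  tendsto_atTop_ciInf (h.W_anti x hx) ⟨0, by rintro _ ⟨n, rfl⟩; exact h.W_nonneg n x hx⟩

/-- The generating function of the number of cars that a vertex of the spine receives from outside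
the spine. -/
lemma exp_mul_H (h : FlowRecursion α G H W) (n : ℕ) {x : ℝ} (hx : x ∈ Icc (0 : ℝ) 1) :
    Real.exp (-(α * (1 - x))) * ((1 + H n x) / 2) =
      Real.exp (-(α * (1 - x) / 2)) * √(G (n + 1) x) := by
  have h1 : Real.exp (-(α * (1 - x))) = Real.exp (-(α * (1 - x) / 2)) ^ 2 := by
    rw [← Real.exp_nat_mul]
    congr 1
    push_cast
    ring
  have h2 := h.H_nonneg n x hx
  rw [h.G_succ n x hx, h1, ← mul_pow, Real.sqrt_sq (by positivity)]
  ring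

lemma isFlowLimit (h : FlowRecursion α G H W) : IsFlowLimit α fun x => ⨅ n, G n x := by
  have h0 : (0 : ℝ) ∈ Icc (0 : ℝ) 1 := ⟨le_rfl, zero_le_one⟩
  refine ⟨h.nonneg, fun x hx => ?_, ?_, fun x hx y hy hxy => ?_, fun x hx y hy hxy => ?_,
    fun x hx => ?_⟩
  · exact le_of_tendsto' (h.tendsto_G hx) fun n => h.G_le_one n x hx
  · refine lt_of_lt_of_le (b := Real.exp (-α) * (1 / 4)) (by positivity)
      (ge_of_tendsto ((h.tendsto_G h0).comp (tendsto_add_atTop_nat 1))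
        (Eventually.of_forall fun n => ?_))
    have h1 := h.H_nonneg n 0 h0
    simp only [Function.comp_apply]
    rw [h.G_succ n 0 h0, sub_zero, mul_one]
    gcongr
    nlinarith
  · exact le_of_tendsto_of_tendsto' (h.tendsto_G hx) (h.tendsto_G hy) fun n =>
      h.G_mono n hx hy hxy
  · exact le_of_tendsto' (((h.tendsto_G hy).sub (h.tendsto_G hx)).const_mul (1 - x)) fun n =>
      h.G_lipschitz n x hx y hy hxy
  · have hlim := h.tendsto_G hx
    have hlim' := (hlim.comp (tendsto_add_atTop_nat 1)).sqrt
    have heq : ∀ n, 2 * x * Real.exp (α * (1 - x) / 2) * √(G (n + 1) x) =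
        x + G n x - (1 - x) * G n 0 := by
      intro n
      have h1 := h.exp_mul_H n hx
      have h2 : √(G (n + 1) x) = Real.exp (α * (1 - x) / 2) *
          (Real.exp (-(α * (1 - x) / 2)) * √(G (n + 1) x)) := by
        rw [← mul_assoc, ← Real.exp_add]
        simp
      have h3 : Real.exp (α * (1 - x) / 2) * Real.exp (α * (1 - x) / 2) *
          Real.exp (-(α * (1 - x))) = 1 := by
        rw [← Real.exp_add, ← Real.exp_add]
        ring_nf
        simp
      rw [h2, ← h1]
      linear_combination (x * (1 + H n x)) * h3 + h.mul_H n x hx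
    have hlim2 : Tendsto (fun n => 2 * x * Real.exp (α * (1 - x) / 2) * √(G (n + 1) x)) atTop
        (𝓝 (x + (⨅ n, G n x) - (1 - x) * ⨅ n, G n 0)) := by
      simp only [heq]
      exact (hlim.const_add x).sub ((h.tendsto_G h0).const_mul (1 - x))
    have key := tendsto_nhds_unique (hlim'.const_mul (2 * x * Real.exp (α * (1 - x) / 2))) hlim2
    have h4 : √(⨅ n, G n x) ^ 2 = ⨅ n, G n x :=
      Real.sq_sqrt (ge_of_tendsto' hlim fun n => h.G_nonneg n x hx)
    have h5 : Real.exp (α * (1 - x) / 2) ^ 2 = Real.exp (α * (1 - x)) := by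
      rw [← Real.exp_nat_mul]
      congr 1
      push_cast
      ring
    linear_combination h4 - key + x ^ 2 * h5

/-- The recursion for `W` in the limit of infinite depth; it is in fact an equality. -/
lemma limit_le (h : FlowRecursion α G H W) {x : ℝ} (hx : x ∈ Icc (0 : ℝ) 1) :
    (1 - x) * (Real.exp (-(α / 2)) * √(⨅ n, G n 0) * ⨅ n, W n 0) ≤
      (Real.exp (-(α * (1 - x) / 2)) * √(⨅ n, G n x) - x) * ⨅ n, W n x := by
  have h0 : (0 : ℝ) ∈ Icc (0 : ℝ) 1 := ⟨le_rfl, zero_le_one⟩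
  have hG : ∀ {x : ℝ}, x ∈ Icc (0 : ℝ) 1 →
      Tendsto (fun n => √(G (n + 1) x)) atTop (𝓝 √(⨅ n, G n x)) :=
    fun hx => ((h.tendsto_G hx).comp (tendsto_add_atTop_nat 1)).sqrt
  have hl := (((hG h0).const_mul (Real.exp (-(α / 2)))).mul (h.tendsto_W h0)).const_mul (1 - x)
  have hr := (((hG hx).const_mul (Real.exp (-(α * (1 - x) / 2)))).mul (h.tendsto_W hx)).sub
    (((h.tendsto_W hx).comp (tendsto_add_atTop_nat 1)).const_mul x)
  have := tendsto_nhds_unique (hr.congr fun n => ?_) hl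
  · rw [← this]
    apply le_of_eq
    ring
  · have h1 := h.mul_W_succ n x hx
    have h2 := h.exp_mul_H n h0
    rw [h.exp_mul_H n hx] at h1
    simp only [sub_zero, mul_one] at h2
    rw [h2] at h1
    simp only [Function.comp_apply]
    linear_combination -h1

/-- The value of `F 0 * p` when the root in `IsFlowLimit.sq_eq` is positive: the upper bound comes
from the limiting recursion and `W n ≤ 1`, the lower bound from the recursion at a finite depth `n`,
in which `W (n + 1) ≤ W n`, on letting `x` tend to `1`. -/
lemma eq_of_tendsto (h : FlowRecursion α G H W) {c : ℝ}
    (hc : Tendsto (fun x => (√(⨅ n, G n x) - x * Real.exp (α * (1 - x) / 2)) / (1 - x)) (𝓝[<] 1)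
      (𝓝 c))
    (hpos : ∀ x ∈ Ioo (0 : ℝ) 1, x * Real.exp (α * (1 - x) / 2) < √(⨅ n, G n x)) :
    Real.exp (-(α / 2)) * √(⨅ n, G n 0) * ⨅ n, W n 0 = c := by
  have h0 : (0 : ℝ) ∈ Icc (0 : ℝ) 1 := ⟨le_rfl, zero_le_one⟩
  have hmem : ∀ᶠ x : ℝ in 𝓝[<] 1, x ∈ Ioo (0 : ℝ) 1 := Ioo_mem_nhdsLT (by norm_num)
  have hexp : Tendsto (fun x : ℝ => Real.exp (-(α * (1 - x) / 2))) (𝓝[<] 1) (𝓝 1) := by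
    have : Continuous fun x : ℝ => Real.exp (-(α * (1 - x) / 2)) := by fun_prop
    simpa using (this.tendsto 1).mono_left nhdsWithin_le_nhds
  have hc' := hexp.mul hc
  rw [one_mul] at hc'
  have hF : ∀ x : ℝ, Real.exp (-(α * (1 - x) / 2)) *
      ((√(⨅ n, G n x) - x * Real.exp (α * (1 - x) / 2)) / (1 - x)) =
      (Real.exp (-(α * (1 - x) / 2)) * √(⨅ n, G n x) - x) / (1 - x) := by
    intro x
    have : Real.exp (-(α * (1 - x) / 2)) * Real.exp (α * (1 - x) / 2) = 1 := by
      rw [← Real.exp_add]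
      simp
    rw [mul_div_assoc', mul_sub]
    congr 1
    linear_combination -x * this
  simp only [hF] at hc'
  have hFpos : ∀ x ∈ Ioo (0 : ℝ) 1,
      0 ≤ (Real.exp (-(α * (1 - x) / 2)) * √(⨅ n, G n x) - x) / (1 - x) := fun x hx => by
    rw [← hF]
    exact mul_nonneg (Real.exp_pos _).le
      (div_nonneg (sub_nonneg.2 (hpos x hx).le) (sub_nonneg.2 hx.2.le))
  apply le_antisymm
  · refine ge_of_tendsto hc' ?_
    filter_upwards [hmem] with x hx
    have hx' : x ∈ Icc (0 : ℝ) 1 := ⟨hx.1.le, hx.2.le⟩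
    have hx1 : 0 < 1 - x := sub_pos.2 hx.2
    have h1 := h.limit_le hx'
    have h2 : ⨅ n, W n x ≤ 1 := le_of_tendsto' (h.tendsto_W hx') fun n => h.W_le_one n x hx'
    have h3 := mul_nonneg (hFpos x hx) hx1.le
    rw [div_mul_cancel₀ _ hx1.ne'] at h3
    rw [le_div_iff₀ hx1]
    nlinarith
  · have hlow : ∀ n, c ≤ Real.exp (-(α / 2)) * √(G (n + 1) 0) * W n 0 := by
      intro n
      have := hc'.mul (h.W_tendsto n)
      rw [mul_one] at this
      refine le_of_tendsto this ?_
      filter_upwards [hmem] with x hx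
      have hx' : x ∈ Icc (0 : ℝ) 1 := ⟨hx.1.le, hx.2.le⟩
      have hx1 : 0 < 1 - x := sub_pos.2 hx.2
      have h1 := h.mul_W_succ n x hx'
      have h2 := h.exp_mul_H n h0
      rw [h.exp_mul_H n hx'] at h1
      simp only [sub_zero, mul_one] at h2
      rw [h2] at h1
      have h3 : W (n + 1) x ≤ W n x := h.W_anti x hx' n.le_succ
      have h4 : √(⨅ n, G n x) ≤ √(G (n + 1) x) :=
        Real.sqrt_le_sqrt ((h.G_anti x hx').le_of_tendsto (h.tendsto_G hx') (n + 1))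
      have h5 := mul_le_mul_of_nonneg_right
        (mul_le_mul_of_nonneg_left h4 (Real.exp_pos (-(α * (1 - x) / 2))).le)
        (h.W_nonneg n x hx')
      have h6 := mul_le_mul_of_nonneg_left h3 hx.1.le
      rw [div_mul_eq_mul_div, div_le_iff₀ hx1]
      linarith
    exact ge_of_tendsto' (((((h.tendsto_G h0).comp (tendsto_add_atTop_nat 1)).sqrt).const_mul
      (Real.exp (-(α / 2)))).mul (h.tendsto_W h0)) hlow

/-- The limit of `W n 0`, the probability that all cars park on the truncated Kesten tree. -/
theorem iInf_W_zero (h : FlowRecursion α G H W) :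
    ⨅ n, W n 0 = if α ≤ 2 - √2 then
      Real.exp (α / 2) * √((α ^ 2 - 4 * α + 2) / (2 * (1 - α))) else 0 := by
  have h0 : (0 : ℝ) ∈ Icc (0 : ℝ) 1 := ⟨le_rfl, zero_le_one⟩
  have hL := h.isFlowLimit
  have hg0 : 0 < ⨅ n, G n 0 := hL.pos_zero
  by_cases hpos : ∀ x ∈ Ioo (0 : ℝ) 1, x * Real.exp (α * (1 - x) / 2) < √(⨅ n, G n x)
  · obtain ⟨hg, hc, hlim⟩ := hL.zero_eq_and_tendsto hpos
    have key := h.eq_of_tendsto hlim hpos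
    rw [hg] at key hg0
    have h2 : √2 ^ 2 = 2 := Real.sq_sqrt (by norm_num)
    have h3 : 0 ≤ √2 := by positivity
    have hle : α ≤ 2 - √2 := by
      by_contra! hlt
      nlinarith
    rw [if_pos hle, ← div_div, Real.sqrt_div hc, ← key]
    have h4 : Real.exp (α / 2) * Real.exp (-(α / 2)) = 1 := by
      rw [← Real.exp_add]
      simp
    have h5 : √(1 - α) ≠ 0 := (Real.sqrt_pos.2 hg0).ne'
    rw [← mul_div_assoc, eq_div_iff h5]
    linear_combination -(√(1 - α) * ⨅ n, W n 0) * h4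
  · push Not at hpos
    obtain ⟨x, hx, hle⟩ := hpos
    have hx' : x ∈ Icc (0 : ℝ) 1 := ⟨hx.1.le, hx.2.le⟩
    rw [if_neg fun hα => (hL.lt_sqrt hα ⟨hx.1.le, hx.2⟩).not_ge hle]
    refine le_antisymm ?_ (ge_of_tendsto' (h.tendsto_W h0) fun n => h.W_nonneg n 0 h0)
    have h1 := h.limit_le hx'
    have h2 : Real.exp (-(α * (1 - x) / 2)) * √(⨅ n, G n x) - x ≤ 0 := by
      have h3 := mul_le_mul_of_nonneg_left hle (Real.exp_pos (-(α * (1 - x) / 2))).le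
      have h4 : Real.exp (-(α * (1 - x) / 2)) * Real.exp (α * (1 - x) / 2) = 1 := by
        rw [← Real.exp_add]
        simp
      linear_combination h3 + x * h4
    have h5 := h1.trans (mul_nonpos_of_nonpos_of_nonneg h2
      (ge_of_tendsto' (h.tendsto_W hx') fun n => h.W_nonneg n x hx'))
    by_contra! hlt
    have h6 : 0 < (1 - x) * (Real.exp (-(α / 2)) * √(⨅ n, G n 0) * ⨅ n, W n 0) := by
      have := sub_pos.2 hx.2
      positivity
    linarith

end FlowRecursion

end Analysis

/-! ### Probability generating functions -/

section GenFun

open Filter Topology Set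

lemma measurable_pow_nat {Ω : Type*} {m : MeasurableSpace Ω} {X : Ω → ℕ} (hX : Measurable[m] X) (x : ℝ) :
    Measurable[m] fun ω => x ^ X ω :=
  (measurable_of_countable fun k : ℕ => x ^ k).comp hX

lemma measurable_sub_one {Ω : Type*} {m : MeasurableSpace Ω} {X : Ω → ℕ} (hX : Measurable[m] X) :
    Measurable[m] fun ω => X ω - 1 :=
  (measurable_of_countable fun k : ℕ => k - 1).comp hX

variable {Ω : Type*} [MeasurableSpace Ω] {μ : Measure Ω}

/-- The probability generating function of a random variable with values in `ℕ`. -/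
noncomputable def genFun (μ : Measure Ω) (X : Ω → ℕ) (x : ℝ) : ℝ := ∫ ω, x ^ X ω ∂μ

variable {X Y : Ω → ℕ} {x y : ℝ}

lemma genFun_nonneg (hx : x ∈ Icc (0 : ℝ) 1) : 0 ≤ genFun μ X x :=
  integral_nonneg fun _ => pow_nonneg hx.1 _

lemma genFun_zero (hX : Measurable X) : genFun μ X 0 = μ.real {ω | X ω = 0} := by
  have hs : MeasurableSet {ω | X ω = 0} := hX (measurableSet_singleton 0)
  rw [← integral_indicator_one hs]
  refine integral_congr_ae (ae_of_all _ fun ω => ?_)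
  by_cases h : X ω = 0 <;> simp [h]

lemma genFun_of_map_eq_poissonMeasure {r : ℝ≥0} (hX : Measurable X)
    (h : μ.map X = poissonMeasure r) (x : ℝ) : genFun μ X x = Real.exp (-(r * (1 - x))) := by
  have h1 : genFun μ X x = ∫ k, x ^ k ∂(μ.map X) :=
    (integral_map hX.aemeasurable (measurable_of_countable _).aestronglyMeasurable).symm
  rw [h1, h, integral_poissonMeasure]
  have h2 := (NormedSpace.expSeries_div_hasSum_exp ((r : ℝ) * x)).mul_left (Real.exp (-r))
  rw [← Real.exp_eq_exp_ℝ, ← Real.exp_add] at h2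
  rw [show -((r : ℝ) * (1 - x)) = -r + r * x by ring, ← h2.tsum_eq]
  congr 1
  ext k
  rw [mul_pow, smul_eq_mul]
  ring

lemma integral_ite_eq_of_map_eq {ν : Measure ℕ} (hX : Measurable X) (h : μ.map X = ν) (k : ℕ) :
    ∫ ω, (if X ω = k then (1 : ℝ) else 0) ∂μ = ν.real {k} := by
  have hs : MeasurableSet {ω | X ω = k} := hX (measurableSet_singleton k)
  rw [← h, map_measureReal_apply hX (measurableSet_singleton k)]
  change _ = μ.real {ω | X ω = k}
  rw [← integral_indicator_one hs]
  refine integral_congr_ae (ae_of_all _ fun ω => ?_)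
  by_cases h : X ω = k <;> simp [h]

variable [IsProbabilityMeasure μ]

lemma integrable_of_mem_Icc {f : Ω → ℝ} (hf : Measurable f) (h : ∀ ω, f ω ∈ Icc (0 : ℝ) 1) :
    Integrable f μ :=
  Integrable.of_bound hf.aestronglyMeasurable 1 (ae_of_all _ fun ω => by
    rw [Real.norm_of_nonneg (h ω).1]
    exact (h ω).2)

lemma integrable_pow_nat (hX : Measurable X) (hx : x ∈ Icc (0 : ℝ) 1) :
    Integrable (fun ω => x ^ X ω) μ :=
  integrable_of_mem_Icc (measurable_pow_nat hX x) fun _ =>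
    ⟨pow_nonneg hx.1 _, pow_le_one₀ hx.1 hx.2⟩

lemma genFun_anti (hX : Measurable X) (hY : Measurable Y) (h : ∀ ω, X ω ≤ Y ω)
    (hx : x ∈ Icc (0 : ℝ) 1) : genFun μ Y x ≤ genFun μ X x :=
  integral_mono (integrable_pow_nat hY hx) (integrable_pow_nat hX hx)
    fun ω => pow_le_pow_of_le_one hx.1 hx.2 (h ω)

lemma genFun_le_one (hX : Measurable X) (hx : x ∈ Icc (0 : ℝ) 1) : genFun μ X x ≤ 1 := by
  have := genFun_anti (μ := μ) (X := fun _ => 0) measurable_const hX (fun _ => Nat.zero_le _) hx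
  simpa [genFun] using this

lemma monotoneOn_genFun (hX : Measurable X) : MonotoneOn (genFun μ X) (Icc 0 1) :=
  fun _ hx _ hy hxy => integral_mono (integrable_pow_nat hX hx) (integrable_pow_nat hX hy)
    fun _ => pow_le_pow_left₀ hx.1 hxy _

/-- Convexity of `x ^ k`: the slope from `x` to `y` is at most the slope from `x` to `1`. -/
lemma one_sub_mul_pow_sub_pow_le (hx : x ∈ Icc (0 : ℝ) 1) (hy : y ∈ Icc (0 : ℝ) 1) (hxy : x ≤ y)
    (k : ℕ) : (1 - x) * (y ^ k - x ^ k) ≤ (y - x) * (1 - x ^ k) := by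
  induction k with
  | zero => simp
  | succ k ih =>
    have h1 : 0 ≤ (y - x) * (1 - x ^ k) :=
      mul_nonneg (sub_nonneg.2 hxy) (sub_nonneg.2 (pow_le_one₀ hx.1 hx.2))
    have h2 := mul_le_mul_of_nonneg_left ih hy.1
    have h3 := mul_le_of_le_one_left h1 hy.2
    rw [pow_succ, pow_succ]
    nlinarith

lemma one_sub_mul_genFun_sub_le (hX : Measurable X) (hx : x ∈ Icc (0 : ℝ) 1)
    (hy : y ∈ Icc (0 : ℝ) 1) (hxy : x ≤ y) :
    (1 - x) * (genFun μ X y - genFun μ X x) ≤ y - x := by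
  rw [genFun, genFun, ← integral_sub (integrable_pow_nat hX hy) (integrable_pow_nat hX hx),
    ← integral_const_mul]
  have := integral_mono (μ := μ) (((integrable_pow_nat hX hy).sub
    (integrable_pow_nat hX hx)).const_mul (1 - x)) (integrable_const (y - x)) fun ω => by
      refine (one_sub_mul_pow_sub_pow_le hx hy hxy (X ω)).trans
        (mul_le_of_le_one_right (sub_nonneg.2 hxy) ?_)
      linarith [pow_nonneg hx.1 (X ω)]
  simpa using this

lemma continuousOn_genFun (hX : Measurable X) : ContinuousOn (genFun μ X) (Icc 0 1) :=
  continuousOn_of_dominated (bound := fun _ => 1)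
    (fun x _ => (measurable_pow_nat hX x).aestronglyMeasurable)
    (fun x hx => ae_of_all _ fun ω => by
      rw [norm_pow, Real.norm_of_nonneg hx.1]
      exact pow_le_one₀ hx.1 hx.2)
    (integrable_const _) (ae_of_all _ fun ω => (continuous_pow (X ω)).continuousOn)

lemma genFun_one : genFun μ X 1 = 1 := by
  simp [genFun]

lemma mul_genFun_sub_one (hX : Measurable X) (hx : x ∈ Icc (0 : ℝ) 1) :
    x * genFun μ (fun ω => X ω - 1) x = genFun μ X x - (1 - x) * genFun μ X 0 := by
  rw [genFun, genFun, genFun, ← integral_const_mul, ← integral_const_mul, ← integral_sub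
    (integrable_pow_nat hX hx) ((integrable_pow_nat hX ⟨le_rfl, zero_le_one⟩).const_mul _)]
  refine integral_congr_ae (ae_of_all _ fun ω => ?_)
  dsimp only
  rcases X ω with _ | k
  · simp
  · simp [pow_succ']

/-- The generating function of `X` determines that of `X - 1`, at `0` by continuity. -/
lemma genFun_sub_one_congr (hX : Measurable X) (hY : Measurable Y)
    (h : ∀ x ∈ Icc (0 : ℝ) 1, genFun μ X x = genFun μ Y x) (hx : x ∈ Icc (0 : ℝ) 1) :
    genFun μ (fun ω => X ω - 1) x = genFun μ (fun ω => Y ω - 1) x := by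
  have h0 : (0 : ℝ) ∈ Icc (0 : ℝ) 1 := ⟨le_rfl, zero_le_one⟩
  have key : ∀ x ∈ Ioc (0 : ℝ) 1,
      genFun μ (fun ω => X ω - 1) x = genFun μ (fun ω => Y ω - 1) x := by
    intro x hx
    have hx' : x ∈ Icc (0 : ℝ) 1 := ⟨hx.1.le, hx.2⟩
    refine mul_left_cancel₀ hx.1.ne' ?_
    rw [mul_genFun_sub_one hX hx', mul_genFun_sub_one hY hx', h x hx', h 0 h0]
  rcases hx.1.eq_or_lt with rfl | hx0
  · have hlim : ∀ {Z : Ω → ℕ}, Measurable Z →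
        Tendsto (genFun μ Z) (𝓝[Ioc 0 1] 0) (𝓝 (genFun μ Z 0)) := fun hZ =>
      (continuousOn_genFun hZ 0 h0).mono_left (nhdsWithin_mono _ Ioc_subset_Icc_self)
    have : (𝓝[Ioc (0 : ℝ) 1] 0).NeBot := by
      rw [nhdsWithin_Ioc_eq_nhdsGT one_pos]
      infer_instance
    refine tendsto_nhds_unique (hlim (measurable_sub_one hX))
      ((hlim (measurable_sub_one hY)).congr' ?_)
    filter_upwards [self_mem_nhdsWithin] with z hz using (key z hz).symm
  · exact key x ⟨hx0, hx.2⟩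

end GenFun

lemma offspringLaw_real_zero : offspringLaw.real {0} = 1 / 4 := by
  rw [offspringLaw, binomial_real_singleton]
  norm_num

lemma offspringLaw_real_one : offspringLaw.real {1} = 1 / 2 := by
  rw [offspringLaw, binomial_real_singleton]
  norm_num

lemma offspringLaw_real_two : offspringLaw.real {2} = 1 / 4 := by
  rw [offspringLaw, binomial_real_singleton]
  norm_num

lemma sizeBiasedShift_real_singleton (ν : Measure ℕ) (k : ℕ) :
    (sizeBiasedShift ν).real {k} = (k + 1) * ν.real {k + 1} := by
  rw [measureReal_def, sizeBiasedShift, Measure.sum_smul_dirac_singleton, ENNReal.toReal_mul,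
    measureReal_def]
  norm_cast

/-! ### The flow in the random tree -/

section Model

open Filter Topology Set

/-- The index set of the family of all the random variables: those of the numbers of trees attached
to the spine, of the numbers of children, and of the numbers of cars. -/
abbrev Index := ℕ ⊕ ((ℕ × ℕ × Word) ⊕ Vertex)

/-- The vertex to which a random variable of the family belongs. -/
def Index.owner : Index → Vertex :=
  Sum.elim Vertex.spine (Sum.elim (fun q => Vertex.graft q.1 q.2.1 q.2.2) id)

/-- The random variables that belong to the descendants of `v`, itself included. -/
def descendantIndices (v : Vertex) : Set Index := {i | v ∈ pathToRoot i.owner}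

/-- The σ-algebra generated by a subfamily of the random variables `Z`. -/
abbrev subfamilyAlgebra {Ω : Type*} (Z : Index → Ω → ℕ) (S : Set Index) : MeasurableSpace Ω :=
  ⨆ i ∈ S, MeasurableSpace.comap (Z i) ⊤

lemma measurable_subfamilyAlgebra {Ω : Type*} {Z : Index → Ω → ℕ} {S : Set Index} {i : Index} (hi : i ∈ S) :
    Measurable[subfamilyAlgebra Z S] (Z i) :=
  Measurable.of_comap_le (le_iSup₂ (f := fun i _ => MeasurableSpace.comap (Z i) ⊤) i hi)

lemma subfamilyAlgebra_mono {Ω : Type*} {Z : Index → Ω → ℕ} {S T : Set Index} (h : S ⊆ T) :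
    subfamilyAlgebra Z S ≤ subfamilyAlgebra Z T :=
  biSup_mono fun _ hi => h hi

variable {Ω : Type*} [MeasurableSpace Ω]

lemma subfamilyAlgebra_le {Z : Index → Ω → ℕ} (hZ : ∀ i, Measurable (Z i)) (S : Set Index) :
    subfamilyAlgebra Z S ≤ ‹MeasurableSpace Ω› :=
  iSup₂_le fun i _ => (hZ i).comap_le

lemma integral_mul_of_disjoint {μ : Measure Ω} {Z : Index → Ω → ℕ} (hZ : ∀ i, Measurable (Z i))
    (hindep : iIndepFun Z μ) {S T : Set Index} (hST : Disjoint S T) {f g : Ω → ℝ}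
    (hf : Measurable[subfamilyAlgebra Z S] f) (hg : Measurable[subfamilyAlgebra Z T] g) :
    ∫ ω, f ω * g ω ∂μ = (∫ ω, f ω ∂μ) * ∫ ω, g ω ∂μ := by
  have h : Indep (subfamilyAlgebra Z S) (subfamilyAlgebra Z T) μ :=
    indep_iSup_of_disjoint (fun i => (hZ i).comap_le) ((iIndepFun_iff_iIndep _ _ _).1 hindep) hST
  have hfg : IndepFun f g μ := by
    rw [IndepFun_iff_Indep]
    exact indep_of_indep_of_le_left (indep_of_indep_of_le_right h hg.comap_le) hf.comap_le
  exact hfg.integral_fun_mul_eq_mul_integral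
    (hf.mono (subfamilyAlgebra_le hZ S) le_rfl).aestronglyMeasurable
    (hg.mono (subfamilyAlgebra_le hZ T) le_rfl).aestronglyMeasurable

lemma measurable_sum_range {k : Ω → ℕ} (hk : Measurable k) {f : ℕ → Ω → ℕ}
    (hf : ∀ i, Measurable (f i)) : Measurable fun ω => ∑ i ∈ Finset.range (k ω), f i ω := by
  have h : Measurable fun p : ℕ × Ω => ∑ i ∈ Finset.range p.1, f i p.2 :=
    measurable_from_prod_countable_right fun n =>
      Finset.measurable_sum (Finset.range n) fun i _ => hf i
  exact h.comp (hk.prodMk measurable_id)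

/-- The random variables from which the parking process on Kesten's tree is built. -/
structure IsModel (μ : Measure Ω) (α : ℝ≥0) (K : ℕ → Ω → ℕ) (N : ℕ → ℕ → Word → Ω → ℕ)
    (A : Vertex → Ω → ℕ) : Prop where
  measurable_K : ∀ h, Measurable (K h)
  measurable_N : ∀ h i u, Measurable (N h i u)
  measurable_A : ∀ v, Measurable (A v)
  map_K : ∀ h, μ.map (K h) = sizeBiasedShift offspringLaw
  map_N : ∀ h i u, μ.map (N h i u) = offspringLaw
  map_A : ∀ v, μ.map (A v) = poissonMeasure α
  indep : iIndepFun
    (Sum.elim K (Sum.elim (fun q : ℕ × ℕ × Word => N q.1 q.2.1 q.2.2) A)) μ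

/-- The family of all the random variables. -/
def family (K : ℕ → Ω → ℕ) (N : ℕ → ℕ → Word → Ω → ℕ) (A : Vertex → Ω → ℕ) : Index → Ω → ℕ :=
  Sum.elim K (Sum.elim (fun q => N q.1 q.2.1 q.2.2) A)

/-- The flow at a vertex of the random tree. -/
def randomFlow (K : ℕ → Ω → ℕ) (N : ℕ → ℕ → Word → Ω → ℕ) (A : Vertex → Ω → ℕ) (n : ℕ)
    (v : Vertex) (ω : Ω) : ℕ :=
  flow (fun h => K h ω) (fun h i u => N h i u ω) (fun v => A v ω) n v

lemma descendantIndices_subset {v w : Vertex} (h : pathToRoot w = w :: pathToRoot v) :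
    descendantIndices w ⊆ descendantIndices v := fun i hi =>
  mem_pathToRoot_trans (by rw [h]; exact List.mem_cons_of_mem _ (mem_pathToRoot_self v)) hi

lemma disjoint_descendantIndices {p v w : Vertex} (hv : pathToRoot v = v :: pathToRoot p)
    (hw : pathToRoot w = w :: pathToRoot p) (hne : v ≠ w) :
    Disjoint (descendantIndices v) (descendantIndices w) :=
  Set.disjoint_left.2 fun _ hi hi' => hne (eq_of_mem_pathToRoot_of_parent_eq hv hw hi hi')

lemma notMem_descendantIndices {p v : Vertex} {i : Index} (hi : i.owner = p)
    (hv : pathToRoot v = v :: pathToRoot p) : i ∉ descendantIndices v := fun h =>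
  notMem_pathToRoot_of_parent hv (hi ▸ h)

/-- The flow at `v` depends only on the random variables of the descendants of `v`. -/
lemma measurable_randomFlow_subfamilyAlgebra {Ω : Type*} {K : ℕ → Ω → ℕ}
    {N : ℕ → ℕ → Word → Ω → ℕ} {A : Vertex → Ω → ℕ} (n : ℕ) (v : Vertex) :
    Measurable[subfamilyAlgebra (family K N A) (descendantIndices v)]
      (randomFlow K N A n v) := by
  induction n generalizing v with
  | zero => exact @measurable_const _ _ _ (_) 0
  | succ n ih =>
    have hkid : ∀ w, pathToRoot w = w :: pathToRoot v →
        Measurable[subfamilyAlgebra (family K N A) (descendantIndices v)]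
          fun ω => randomFlow K N A n w ω - 1 := fun w hw =>
      measurable_sub_one ((ih w).mono (subfamilyAlgebra_mono (descendantIndices_subset hw)) le_rfl)
    have hA : Measurable[subfamilyAlgebra (family K N A) (descendantIndices v)] (A v) :=
      measurable_subfamilyAlgebra (Z := family K N A) (i := Sum.inr (Sum.inr v))
        (mem_pathToRoot_self v)
    let _ : MeasurableSpace Ω := subfamilyAlgebra (family K N A) (descendantIndices v)
    rcases v with h | ⟨h, i, u⟩
    · have hK : Measurable (K h) := measurable_subfamilyAlgebra (Z := family K N A)
        (i := Sum.inl h) (mem_pathToRoot_self (Vertex.spine h))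
      have : randomFlow K N A (n + 1) (Vertex.spine h) = fun ω => A (Vertex.spine h) ω +
          ((randomFlow K N A n (Vertex.spine (h + 1)) ω - 1) +
          ∑ i ∈ Finset.range (K h ω), (randomFlow K N A n (Vertex.graft h i []) ω - 1)) :=
        funext fun ω => flow_spine_succ n h
      rw [this]
      exact hA.add ((hkid _ rfl).add (measurable_sum_range hK fun i => hkid _ rfl))
    · have hN : Measurable (N h i u) := measurable_subfamilyAlgebra (Z := family K N A)
        (i := Sum.inr (Sum.inl (h, i, u))) (mem_pathToRoot_self (Vertex.graft h i u))
      have : randomFlow K N A (n + 1) (Vertex.graft h i u) = fun ω => A (Vertex.graft h i u) ω +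
          ∑ j : Fin 2, if (j : ℕ) < N h i u ω
            then randomFlow K N A n (Vertex.graft h i (j :: u)) ω - 1 else 0 :=
        funext fun ω => flow_graft_succ n h i u
      rw [this]
      exact hA.add (Finset.measurable_sum _ fun j _ =>
        Measurable.ite (hN (measurableSet_Ioi (a := (j : ℕ)))) (hkid _ rfl) measurable_const)

namespace IsModel

variable {μ : Measure Ω} {α : ℝ≥0} {K : ℕ → Ω → ℕ} {N : ℕ → ℕ → Word → Ω → ℕ}
  {A : Vertex → Ω → ℕ}

lemma measurable_family (h : IsModel μ α K N A) (i : Index) : Measurable (family K N A i) := by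
  rcases i with i | i | i
  · exact h.measurable_K i
  · exact h.measurable_N _ _ _
  · exact h.measurable_A i

lemma ae_K_le_one (hM : IsModel μ α K N A) (h : ℕ) : ∀ᵐ ω ∂μ, K h ω ≤ 1 := by
  refine ae_of_ae_map (p := fun k => k ≤ 1) (hM.measurable_K h).aemeasurable ?_
  rw [hM.map_K, ae_iff_of_countable]
  intro k hk
  by_contra! hlt
  refine hk ?_
  rw [sizeBiasedShift, Measure.sum_smul_dirac_singleton, offspringLaw, binomial_singleton,
    Nat.choose_eq_zero_of_lt (by omega)]
  simp

lemma measurable_randomFlow (h : IsModel μ α K N A) (n : ℕ) (v : Vertex) :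
    Measurable (randomFlow K N A n v) :=
  (measurable_randomFlow_subfamilyAlgebra n v).mono
    (subfamilyAlgebra_le h.measurable_family _) le_rfl

lemma setOf_allCarsPark_eq {Ω : Type*} (K : ℕ → Ω → ℕ) (N : ℕ → ℕ → Word → Ω → ℕ)
    (A : Vertex → Ω → ℕ) :
    {ω | AllCarsPark (kestenTree (fun h => K h ω) (fun h i u => N h i u ω)) (fun v => A v ω)} =
      ⋂ n, {ω | randomFlow K N A n (Vertex.spine 0) ω - 1 = 0} := by
  ext ω
  simp only [Set.mem_ofPred_eq, Set.mem_iInter, allCarsPark_iff_flow_le_one, randomFlow,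
    Nat.sub_eq_zero_iff_le]

lemma measurableSet_randomFlow_sub_one_eq_zero (hM : IsModel μ α K N A) (n : ℕ) :
    MeasurableSet {ω | randomFlow K N A n (Vertex.spine 0) ω - 1 = 0} :=
  measurable_sub_one (hM.measurable_randomFlow n _) (measurableSet_singleton 0)

lemma measurableSet_allCarsPark (hM : IsModel μ α K N A) :
    MeasurableSet {ω | AllCarsPark (kestenTree (fun h => K h ω) (fun h i u => N h i u ω))
      (fun v => A v ω)} := by
  rw [setOf_allCarsPark_eq]
  exact MeasurableSet.iInter hM.measurableSet_randomFlow_sub_one_eq_zero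

variable [IsProbabilityMeasure μ]

/-- The generating function of the flow, by independence; `1 / 4`, `1 / 2`, `1 / 4` are the
probabilities of `0`, `1`, `2` children. -/
lemma genFun_graft_succ (hM : IsModel μ α K N A) (n h i : ℕ) (u : Word) {x : ℝ}
    (hx : x ∈ Icc (0 : ℝ) 1) :
    genFun μ (randomFlow K N A (n + 1) (Vertex.graft h i u)) x =
      Real.exp (-(α * (1 - x))) * (1 / 4 +
        1 / 2 * genFun μ (fun ω => randomFlow K N A n (Vertex.graft h i (0 :: u)) ω - 1) x +
        1 / 4 * (genFun μ (fun ω => randomFlow K N A n (Vertex.graft h i (0 :: u)) ω - 1) x *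
          genFun μ (fun ω => randomFlow K N A n (Vertex.graft h i (1 :: u)) ω - 1) x)) := by
  set c : ℕ → Ω → ℝ := fun k ω => if N h i u ω = k then 1 else 0 with hc
  set F : Fin 2 → Ω → ℝ := fun j ω => x ^ (randomFlow K N A n (Vertex.graft h i (j :: u)) ω - 1)
    with hF
  set d : Set Index := {Sum.inr (Sum.inl (h, i, u))} with hd
  set D : Fin 2 → Set Index := fun j => descendantIndices (Vertex.graft h i (j :: u)) with hD
  have hmF : ∀ j, Measurable[subfamilyAlgebra (family K N A) (D j)] (F j) := fun j =>
    measurable_pow_nat (measurable_sub_one (measurable_randomFlow_subfamilyAlgebra n _)) x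
  have hmN : Measurable[subfamilyAlgebra (family K N A) d] (N h i u) :=
    measurable_subfamilyAlgebra (Z := family K N A) (i := Sum.inr (Sum.inl (h, i, u))) rfl
  have hmc : ∀ k, Measurable[subfamilyAlgebra (family K N A) d] (c k) := fun k =>
    (measurable_of_countable fun m : ℕ => if m = k then (1 : ℝ) else 0).comp hmN
  have hmc2 : Measurable[subfamilyAlgebra (family K N A) d] fun ω => 1 - c 0 ω - c 1 ω :=
    (measurable_of_countable fun m : ℕ =>
      1 - (if m = 0 then (1 : ℝ) else 0) - (if m = 1 then (1 : ℝ) else 0)).comp hmN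
  have hmA : Measurable[subfamilyAlgebra (family K N A) {Sum.inr (Sum.inr (Vertex.graft h i u))}]
      fun ω => x ^ A (Vertex.graft h i u) ω :=
    measurable_pow_nat (measurable_subfamilyAlgebra (Z := family K N A)
      (i := Sum.inr (Sum.inr (Vertex.graft h i u))) (Set.mem_singleton _)) x
  have hdD : ∀ j, Disjoint d (D j) := fun j => by
    rw [hd, Set.disjoint_singleton_left]
    exact notMem_descendantIndices (p := Vertex.graft h i u) rfl rfl
  have hD01 : Disjoint (D 0) (D 1) :=
    disjoint_descendantIndices (p := Vertex.graft h i u) rfl rfl (by simp)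
  have hF1 : ∀ j ω, F j ω ∈ Icc (0 : ℝ) 1 := fun j ω =>
    ⟨pow_nonneg hx.1 _, pow_le_one₀ hx.1 hx.2⟩
  have hc1 : ∀ k ω, c k ω ∈ Icc (0 : ℝ) 1 := fun k ω => by
    simp only [hc]
    split_ifs <;> simp
  have hc2 : ∀ ω, 1 - c 0 ω - c 1 ω ∈ Icc (0 : ℝ) 1 := fun ω => by
    simp only [hc]
    split_ifs <;> first | omega | simp
  have hle := subfamilyAlgebra_le hM.measurable_family
  have hmF' : ∀ j, Measurable (F j) := fun j => (hmF j).mono (hle _) le_rfl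
  have hmc' : ∀ k, Measurable (c k) := fun k => (hmc k).mono (hle _) le_rfl
  have hmc2' : Measurable fun ω => 1 - c 0 ω - c 1 ω := hmc2.mono (hle _) le_rfl
  have hi1 : Integrable (fun ω => c 1 ω * F 0 ω) μ := integrable_of_mem_Icc ((hmc' 1).mul (hmF' 0))
    fun ω => unitInterval.mul_mem (hc1 1 ω) (hF1 0 ω)
  have hi2 : Integrable (fun ω => (1 - c 0 ω - c 1 ω) * (F 0 ω * F 1 ω)) μ :=
    integrable_of_mem_Icc (hmc2'.mul ((hmF' 0).mul (hmF' 1)))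
    fun ω => unitInterval.mul_mem (hc2 ω) (unitInterval.mul_mem (hF1 0 ω) (hF1 1 ω))
  have hpt : ∀ ω, x ^ randomFlow K N A (n + 1) (Vertex.graft h i u) ω =
      x ^ A (Vertex.graft h i u) ω *
        (c 0 ω + c 1 ω * F 0 ω + (1 - c 0 ω - c 1 ω) * (F 0 ω * F 1 ω)) := by
    intro ω
    rw [randomFlow, flow_graft_succ, pow_add, Fin.sum_univ_two, pow_add]
    congr 1
    simp only [hc, hF, randomFlow, Fin.val_zero, Fin.val_one]
    rcases hNk : N h i u ω with _ | _ | k <;> simp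
  have hmR : Measurable[subfamilyAlgebra (family K N A) (d ∪ (D 0 ∪ D 1))] fun ω =>
      c 0 ω + c 1 ω * F 0 ω + (1 - c 0 ω - c 1 ω) * (F 0 ω * F 1 ω) := by
    have h1 := fun k => (hmc k).mono
      (subfamilyAlgebra_mono (Set.subset_union_left : d ⊆ d ∪ (D 0 ∪ D 1))) le_rfl
    have h2 := hmc2.mono
      (subfamilyAlgebra_mono (Set.subset_union_left : d ⊆ d ∪ (D 0 ∪ D 1))) le_rfl
    have h3 := (hmF 0).mono (subfamilyAlgebra_mono
      (Set.subset_union_left.trans Set.subset_union_right : D 0 ⊆ d ∪ (D 0 ∪ D 1))) le_rfl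
    have h4 := (hmF 1).mono (subfamilyAlgebra_mono
      (Set.subset_union_right.trans Set.subset_union_right : D 1 ⊆ d ∪ (D 0 ∪ D 1))) le_rfl
    exact ((h1 0).add ((h1 1).mul h3)).add (h2.mul (h3.mul h4))
  have hmFF : Measurable[subfamilyAlgebra (family K N A) (D 0 ∪ D 1)] fun ω => F 0 ω * F 1 ω :=
    ((hmF 0).mono (subfamilyAlgebra_mono Set.subset_union_left) le_rfl).mul
      ((hmF 1).mono (subfamilyAlgebra_mono Set.subset_union_right) le_rfl)
  have hpc0 : ∫ ω, c 0 ω ∂μ = 1 / 4 :=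
    (integral_ite_eq_of_map_eq (hM.measurable_N h i u) (hM.map_N h i u) 0).trans
      offspringLaw_real_zero
  have hpc1 : ∫ ω, c 1 ω ∂μ = 1 / 2 :=
    (integral_ite_eq_of_map_eq (hM.measurable_N h i u) (hM.map_N h i u) 1).trans
      offspringLaw_real_one
  have hic : ∀ k, Integrable (c k) μ := fun k => integrable_of_mem_Icc (hmc' k) (hc1 k)
  have hpc2 : ∫ ω, (1 - c 0 ω - c 1 ω) ∂μ = 1 / 4 := by
    have h1 : Integrable (fun ω => 1 - c 0 ω) μ := (integrable_const 1).sub (hic 0)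
    rw [integral_sub h1 (hic 1),
      integral_sub (integrable_const 1) (hic 0), hpc0, hpc1]
    norm_num [integral_const]
  have hi3 : Integrable (fun ω => c 0 ω + c 1 ω * F 0 ω) μ := (hic 0).add hi1
  have hdisj : Disjoint {Sum.inr (Sum.inr (Vertex.graft h i u))} (d ∪ (D 0 ∪ D 1)) := by
    rw [Set.disjoint_singleton_left]
    rintro (hm | hm | hm)
    · simp [hd] at hm
    · exact notMem_descendantIndices (p := Vertex.graft h i u) rfl rfl hm
    · exact notMem_descendantIndices (p := Vertex.graft h i u) rfl rfl hm
  have hA : ∫ ω, x ^ A (Vertex.graft h i u) ω ∂μ = Real.exp (-(α * (1 - x))) :=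
    genFun_of_map_eq_poissonMeasure (hM.measurable_A _) (hM.map_A _) x
  simp only [genFun, hpt]
  rw [integral_mul_of_disjoint hM.measurable_family hM.indep hdisj hmA hmR, hA,
    integral_add hi3 hi2, integral_add (hic 0) hi1,
    integral_mul_of_disjoint hM.measurable_family hM.indep (hdD 0) (hmc 1) (hmF 0),
    integral_mul_of_disjoint hM.measurable_family hM.indep
      (Set.disjoint_union_right.2 ⟨hdD 0, hdD 1⟩) hmc2 hmFF,
    integral_mul_of_disjoint hM.measurable_family hM.indep hD01 (hmF 0) (hmF 1),
    hpc0, hpc1, hpc2]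

/-- The generating function of the flow, by independence; the two `1 / 2` are the probabilities of
`0` and `1` trees attached to the vertex. -/
lemma genFun_spine_succ (hM : IsModel μ α K N A) (n h : ℕ) {x : ℝ} (hx : x ∈ Icc (0 : ℝ) 1) :
    genFun μ (randomFlow K N A (n + 1) (Vertex.spine h)) x =
      Real.exp (-(α * (1 - x))) *
        (genFun μ (fun ω => randomFlow K N A n (Vertex.spine (h + 1)) ω - 1) x *
        (1 / 2 + 1 / 2 * genFun μ (fun ω => randomFlow K N A n (Vertex.graft h 0 []) ω - 1) x)) := by
  set c : ℕ → Ω → ℝ := fun k ω => if K h ω = k then 1 else 0 with hc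
  set F : Vertex → Ω → ℝ := fun v ω => x ^ (randomFlow K N A n v ω - 1) with hF
  set d : Set Index := {Sum.inl h} with hd
  set D : Vertex → Set Index := descendantIndices with hD
  set s := Vertex.spine (h + 1) with hs
  set g := Vertex.graft h 0 [] with hg
  have hmF : ∀ v, Measurable[subfamilyAlgebra (family K N A) (D v)] (F v) := fun v =>
    measurable_pow_nat (measurable_sub_one (measurable_randomFlow_subfamilyAlgebra n v)) x
  have hmc : ∀ k, Measurable[subfamilyAlgebra (family K N A) d] (c k) := fun k =>
    (measurable_of_countable fun m : ℕ => if m = k then (1 : ℝ) else 0).comp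
      (measurable_subfamilyAlgebra (Z := family K N A) (i := Sum.inl h) rfl)
  have hmA : Measurable[subfamilyAlgebra (family K N A) {Sum.inr (Sum.inr (Vertex.spine h))}]
      fun ω => x ^ A (Vertex.spine h) ω :=
    measurable_pow_nat (measurable_subfamilyAlgebra (Z := family K N A)
      (i := Sum.inr (Sum.inr (Vertex.spine h))) (Set.mem_singleton _)) x
  have hdg : Disjoint d (D g) := by
    rw [hd, Set.disjoint_singleton_left]
    exact notMem_descendantIndices (p := Vertex.spine h) rfl rfl
  have hsdg : Disjoint (D s) (d ∪ D g) := by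
    refine Set.disjoint_union_right.2 ⟨?_, ?_⟩
    · rw [hd, Set.disjoint_singleton_right]
      exact notMem_descendantIndices (p := Vertex.spine h) rfl rfl
    · exact disjoint_descendantIndices (p := Vertex.spine h) rfl rfl (by simp [hs, hg])
  have hAdisj : Disjoint {Sum.inr (Sum.inr (Vertex.spine h))} (D s ∪ (d ∪ D g)) := by
    rw [Set.disjoint_singleton_left]
    rintro (hm | hm | hm)
    · exact notMem_descendantIndices (p := Vertex.spine h) rfl rfl hm
    · simp [hd] at hm
    · exact notMem_descendantIndices (p := Vertex.spine h) rfl rfl hm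
  have hle := subfamilyAlgebra_le hM.measurable_family
  have hc1 : ∀ k ω, c k ω ∈ Icc (0 : ℝ) 1 := fun k ω => by
    simp only [hc]
    split_ifs <;> simp
  have hic : ∀ k, Integrable (c k) μ := fun k =>
    integrable_of_mem_Icc ((hmc k).mono (hle _) le_rfl) (hc1 k)
  have hi1 : Integrable (fun ω => c 1 ω * F g ω) μ := integrable_of_mem_Icc
    (((hmc 1).mono (hle _) le_rfl).mul ((hmF g).mono (hle _) le_rfl))
    fun ω => unitInterval.mul_mem (hc1 1 ω) ⟨pow_nonneg hx.1 _, pow_le_one₀ hx.1 hx.2⟩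
  have hmR : Measurable[subfamilyAlgebra (family K N A) (d ∪ D g)]
      fun ω => c 0 ω + c 1 ω * F g ω := by
    have h1 := fun k => (hmc k).mono
      (subfamilyAlgebra_mono (Set.subset_union_left : d ⊆ d ∪ D g)) le_rfl
    have h2 := (hmF g).mono
      (subfamilyAlgebra_mono (Set.subset_union_right : D g ⊆ d ∪ D g)) le_rfl
    exact (h1 0).add ((h1 1).mul h2)
  have hmFR : Measurable[subfamilyAlgebra (family K N A) (D s ∪ (d ∪ D g))]
      fun ω => F s ω * (c 0 ω + c 1 ω * F g ω) :=
    ((hmF s).mono (subfamilyAlgebra_mono Set.subset_union_left) le_rfl).mul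
      (hmR.mono (subfamilyAlgebra_mono Set.subset_union_right) le_rfl)
  have hpc0 : ∫ ω, c 0 ω ∂μ = 1 / 2 := by
    rw [integral_ite_eq_of_map_eq (hM.measurable_K h) (hM.map_K h) 0,
      sizeBiasedShift_real_singleton, offspringLaw_real_one]
    norm_num
  have hpc1 : ∫ ω, c 1 ω ∂μ = 1 / 2 := by
    rw [integral_ite_eq_of_map_eq (hM.measurable_K h) (hM.map_K h) 1,
      sizeBiasedShift_real_singleton, offspringLaw_real_two]
    norm_num
  have hA : ∫ ω, x ^ A (Vertex.spine h) ω ∂μ = Real.exp (-(α * (1 - x))) :=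
    genFun_of_map_eq_poissonMeasure (hM.measurable_A _) (hM.map_A _) x
  have hpt : ∀ᵐ ω ∂μ, x ^ randomFlow K N A (n + 1) (Vertex.spine h) ω =
      x ^ A (Vertex.spine h) ω * (F s ω * (c 0 ω + c 1 ω * F g ω)) := by
    filter_upwards [hM.ae_K_le_one h] with ω hω
    rw [randomFlow, flow_spine_succ, pow_add, pow_add]
    congr 2
    simp only [hc, hF, randomFlow]
    interval_cases hk : K h ω <;> simp [hg]
  simp only [genFun]
  rw [integral_congr_ae hpt,
    integral_mul_of_disjoint hM.measurable_family hM.indep hAdisj hmA hmFR, hA,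
    integral_mul_of_disjoint hM.measurable_family hM.indep hsdg (hmF s) hmR,
    integral_add (hic 0) hi1,
    integral_mul_of_disjoint hM.measurable_family hM.indep hdg (hmc 1) (hmF g), hpc0, hpc1]

/-- The law of the flow at a vertex of one of the attached trees does not depend on the vertex. -/
lemma genFun_graft_congr (hM : IsModel μ α K N A) (n h i : ℕ) (u : Word) {x : ℝ}
    (hx : x ∈ Icc (0 : ℝ) 1) :
    genFun μ (randomFlow K N A n (Vertex.graft h i u)) x =
      genFun μ (randomFlow K N A n (Vertex.graft 0 0 [])) x := by
  induction n generalizing h i u x with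
  | zero => rfl
  | succ n ih =>
    have key : ∀ h i u, genFun μ (fun ω => randomFlow K N A n (Vertex.graft h i u) ω - 1) x =
        genFun μ (fun ω => randomFlow K N A n (Vertex.graft 0 0 []) ω - 1) x := fun h i u =>
      genFun_sub_one_congr (hM.measurable_randomFlow _ _) (hM.measurable_randomFlow _ _)
        (fun y hy => ih h i u hy) hx
    rw [hM.genFun_graft_succ n h i u hx, hM.genFun_graft_succ n 0 0 [] hx, key h i (0 :: u),
      key h i (1 :: u), key 0 0 [0], key 0 0 [1]]

lemma genFun_graft_sub_one_congr (hM : IsModel μ α K N A) (n h i : ℕ) (u : Word) {x : ℝ}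
    (hx : x ∈ Icc (0 : ℝ) 1) :
    genFun μ (fun ω => randomFlow K N A n (Vertex.graft h i u) ω - 1) x =
      genFun μ (fun ω => randomFlow K N A n (Vertex.graft 0 0 []) ω - 1) x :=
  genFun_sub_one_congr (hM.measurable_randomFlow _ _) (hM.measurable_randomFlow _ _)
    (fun _ hy => hM.genFun_graft_congr n h i u hy) hx

/-- The law of the flow at a vertex of the spine does not depend on the vertex. -/
lemma genFun_spine_congr (hM : IsModel μ α K N A) (n h : ℕ) {x : ℝ} (hx : x ∈ Icc (0 : ℝ) 1) :
    genFun μ (randomFlow K N A n (Vertex.spine h)) x =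
      genFun μ (randomFlow K N A n (Vertex.spine 0)) x := by
  induction n generalizing h x with
  | zero => rfl
  | succ n ih =>
    have key : ∀ h, genFun μ (fun ω => randomFlow K N A n (Vertex.spine h) ω - 1) x =
        genFun μ (fun ω => randomFlow K N A n (Vertex.spine 0) ω - 1) x := fun h =>
      genFun_sub_one_congr (hM.measurable_randomFlow _ _) (hM.measurable_randomFlow _ _)
        (fun y hy => ih h hy) hx
    rw [hM.genFun_spine_succ n h hx, hM.genFun_spine_succ n 0 hx, key (h + 1), key (0 + 1),
      hM.genFun_graft_sub_one_congr n h 0 [] hx]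

lemma flowRecursion (hM : IsModel μ α K N A) :
    FlowRecursion α (fun n => genFun μ (randomFlow K N A n (Vertex.graft 0 0 [])))
      (fun n => genFun μ fun ω => randomFlow K N A n (Vertex.graft 0 0 []) ω - 1)
      (fun n => genFun μ fun ω => randomFlow K N A n (Vertex.spine 0) ω - 1) := by
  have hm := hM.measurable_randomFlow
  have h0 : (0 : ℝ) ∈ Icc (0 : ℝ) 1 := ⟨le_rfl, zero_le_one⟩
  have hsucc : ∀ n v ω, randomFlow K N A n v ω ≤ randomFlow K N A (n + 1) v ω :=
    fun n v ω => flow_le_flow_succ n v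
  have hspine : ∀ n, ∀ x ∈ Icc (0 : ℝ) 1,
      genFun μ (randomFlow K N A (n + 1) (Vertex.spine 0)) x =
        Real.exp (-(α * (1 - x))) *
          ((1 + genFun μ (fun ω => randomFlow K N A n (Vertex.graft 0 0 []) ω - 1) x) / 2) *
          genFun μ (fun ω => randomFlow K N A n (Vertex.spine 0) ω - 1) x := by
    intro n x hx
    rw [hM.genFun_spine_succ n 0 hx, genFun_sub_one_congr (hm _ _) (hm _ _)
      (fun y hy => hM.genFun_spine_congr n (0 + 1) hy) hx]
    ring
  refine
    { nonneg := α.2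
      mul_H := fun n x hx => mul_genFun_sub_one (hm _ _) hx
      G_succ := fun n x hx => ?_
      mul_W_succ := fun n x hx => ?_
      G_anti := fun x hx => antitone_nat_of_succ_le fun n =>
        genFun_anti (hm _ _) (hm _ _) (fun ω => hsucc n _ ω) hx
      W_anti := fun x hx => antitone_nat_of_succ_le fun n =>
        genFun_anti (measurable_sub_one (hm _ _)) (measurable_sub_one (hm _ _))
          (fun ω => Nat.sub_le_sub_right (hsucc n _ ω) 1) hx
      G_nonneg := fun n x hx => genFun_nonneg hx
      G_le_one := fun n x hx => genFun_le_one (hm _ _) hx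
      H_nonneg := fun n x hx => genFun_nonneg hx
      W_nonneg := fun n x hx => genFun_nonneg hx
      W_le_one := fun n x hx => genFun_le_one (measurable_sub_one (hm _ _)) hx
      G_mono := fun n => monotoneOn_genFun (hm _ _)
      G_lipschitz := fun n x hx y hy hxy => one_sub_mul_genFun_sub_le (hm _ _) hx hy hxy
      W_tendsto := fun n => ?_ }
  · rw [hM.genFun_graft_succ n 0 0 [] hx, hM.genFun_graft_sub_one_congr n 0 0 [0] hx,
      hM.genFun_graft_sub_one_congr n 0 0 [1] hx]
    ring
  · rw [mul_genFun_sub_one (hm _ _) hx, hspine n x hx, hspine n 0 h0]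
    simp only [sub_zero, mul_one]
  · have h1 := continuousOn_genFun (μ := μ)
      (measurable_sub_one (hm n (Vertex.spine 0))) 1 ⟨zero_le_one, le_rfl⟩
    rw [ContinuousWithinAt, genFun_one] at h1
    refine h1.mono_left ?_
    rw [← nhdsWithin_Ico_eq_nhdsLT (zero_lt_one (α := ℝ))]
    exact nhdsWithin_mono _ Ico_subset_Icc_self

lemma measureReal_allCarsPark (hM : IsModel μ α K N A) :
    μ.real {ω | AllCarsPark (kestenTree (fun h => K h ω) (fun h i u => N h i u ω))
      (fun v => A v ω)} =
      if (α : ℝ) ≤ 2 - √2 then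
        Real.exp ((α : ℝ) / 2) * √(((α : ℝ) ^ 2 - 4 * α + 2) / (2 * (1 - α)))
      else 0 := by
  have hanti : Antitone fun n => {ω | randomFlow K N A n (Vertex.spine 0) ω - 1 = 0} :=
    antitone_nat_of_succ_le fun n ω hω => by
      have := flow_le_flow_succ (k := fun h => K h ω) (c := fun h i u => N h i u ω)
        (a := fun v => A v ω) n (Vertex.spine 0)
      simp only [Set.mem_ofPred_eq, randomFlow] at hω ⊢
      omega
  rw [setOf_allCarsPark_eq, ← hM.flowRecursion.iInf_W_zero]
  refine tendsto_nhds_unique ?_ (hM.flowRecursion.tendsto_W ⟨le_rfl, zero_le_one⟩)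
  simp only [genFun_zero (measurable_sub_one (hM.measurable_randomFlow _ _))]
  exact (ENNReal.tendsto_toReal (measure_ne_top _ _)).comp
    (tendsto_measure_iInter_atTop
      (fun n => (hM.measurableSet_randomFlow_sub_one_eq_zero n).nullMeasurableSet) hanti
      ⟨0, measure_ne_top _ _⟩)

end IsModel

end Model

end KestenParking

theorem mainTheorem3 {Ω : Type*} [MeasurableSpace Ω] (μ : Measure Ω) [IsProbabilityMeasure μ]
    (α : ℝ≥0)
    -- `K h`: number of family trees attached to the `h`-th vertex of the spine
    (K : ℕ → Ω → ℕ)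
    -- `N h i u`: number of children of `u` in the `i`-th tree attached to that vertex
    (N : ℕ → ℕ → KestenParking.Word → Ω → ℕ)
    -- `A v`: number of cars arriving at the vertex `v`
    (A : KestenParking.Vertex → Ω → ℕ)
    (hKm : ∀ h, Measurable (K h)) (hNm : ∀ h i u, Measurable (N h i u))
    (hAm : ∀ v, Measurable (A v))
    (hK : ∀ h, μ.map (K h) = KestenParking.sizeBiasedShift KestenParking.offspringLaw)
    (hN : ∀ h i u, μ.map (N h i u) = KestenParking.offspringLaw)
    (hA : ∀ v, μ.map (A v) = poissonMeasure α)
    (hindep : iIndepFun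
      (Sum.elim K (Sum.elim (fun q : ℕ × ℕ × KestenParking.Word => N q.1 q.2.1 q.2.2) A)) μ) :
    MeasurableSet {ω | KestenParking.AllCarsPark
        (KestenParking.kestenTree (fun h => K h ω) (fun h i u => N h i u ω)) (fun v => A v ω)} ∧
    μ.real {ω | KestenParking.AllCarsPark
        (KestenParking.kestenTree (fun h => K h ω) (fun h i u => N h i u ω)) (fun v => A v ω)} =
      if (α : ℝ) ≤ 2 - √2 then
        Real.exp ((α : ℝ) / 2) * √(((α : ℝ) ^ 2 - 4 * α + 2) / (2 * (1 - α)))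
      else 0 := by
  have hM : KestenParking.IsModel μ α K N A := ⟨hKm, hNm, hAm, hK, hN, hA, hindep⟩
  exact ⟨hM.measurableSet_allCarsPark, hM.measureReal_allCarsPark⟩
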